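/- Let $\mathbb T^2=(\mathbb R/2\pi\mathbb Z)^2$. For $N\ge 2$ let $X_N=\mathrm{span}\{\cos(k\cdot x),\sin(k\cdot x): k\in\mathbb Z^2,\ |k|_\infty\le N\}$ and let $\Pi_N$ be the truncation to the Fourier modes $|k|_\infty\le N$. For $\hat f(k)=\int_{\mathbb T^2}f(x)e^{-ik\cdot x}\,dx$ put $\|f\|_{H^s}=\frac1{2\pi}\big(\sum_{k\in\mathbb Z^2}(1+|k|^{2s})|\hat f(k)|^2\big)^{1/2}$ (for vector fields, sum the squares over the components). Given $u_0:\mathbb T^2\to\mathbb R^2$, $\tau>0$ and $\nu>0$, consider the semi-implicit Fourier spectral scheme, with $u^n\in X_N^2$ and $p^n\in X_N$, $$\frac{u^{n+1}-u^n}{\tau}+\Pi_N(u^n\cdot\nabla u^{n+1})+\nabla p^n=\nu\Delta u^{n+1},\qquad \nabla\cdot u^{n+1}=0,\qquad u^0=\Pi_Nu_0 .$$ **Corollary 1.2 ($H^1$-energy stability).** Let $s>2$. There is a constant $C_s>0$ depending only on $s$, and for every $R>0$ there is a constant $c>0$ depending only on $s$ and $R$, such that the following holds. Let $u_0\in H^s(\mathbb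 T^2;\mathbb R^2)$ satisfy $\nabla\cdot u_0=0$ and $\|u_0\|_{H^s}\le R$, and let $T>0$ satisfy $4C_sT\|u_0\|_{H^s}\le 1$ (for instance $T=\frac1{4C_s\|u_0\|_{H^s}}$ if $u_0\ne0$). Let $N\ge2$ and $M\ge1$ be integers, let $\nu>0$ and $\tau=T/M$, and assume $\tau\le c\,\nu$. Then every solution $(u^n)_{n\ge0}$ of the scheme satisfies, for all $0\le n\le M$, $$\|\nabla u^{n+1}\|_{L^2}^2+\|\nabla(u^{n+1}-u^n)\|_{L^2}^2\le\|\nabla u^n\|_{L^2}^2 ,$$ and consequently $\|u^{n+1}\|_{H^1}\le\|u^n\|_{H^1}$. -/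

import Mathlib

open MeasureTheory

noncomputable section

/-- The periodicity cell `[0, 2π]²` of the torus `𝕋² = (ℝ/2πℤ)²`. -/
def torusCell : Set (Fin 2 → ℝ) := Set.Icc (fun _ => 0) (fun _ => 2 * Real.pi)

/-- `f : ℝ² → ℝ` is `2π`-periodic in each variable, i.e. a function on `𝕋²`. -/
def IsPeriodic (f : (Fin 2 → ℝ) → ℝ) : Prop :=
  ∀ (x : Fin 2 → ℝ) (m : Fin 2 → ℤ), f (fun j => x j + 2 * Real.pi * (m j : ℝ)) = f x

/-- The phase `k · x` for a frequency `k ∈ ℤ²`. -/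
def phase (k : Fin 2 → ℤ) (x : Fin 2 → ℝ) : ℝ := ∑ j, (k j : ℝ) * x j

/-- The Euclidean length `|k|` of a frequency. -/
def freqNorm (k : Fin 2 → ℤ) : ℝ := Real.sqrt (∑ j, (k j : ℝ) ^ 2)

/-- The Fourier coefficient `f̂(k) = ∫_{𝕋²} f(x) e^{-i k·x} dx`. -/
def torusFourierCoeff (f : (Fin 2 → ℝ) → ℝ) (k : Fin 2 → ℤ) : ℂ :=
  ∫ x in torusCell, (f x : ℂ) * Complex.exp (-(Complex.I * (phase k x : ℂ)))

/-- The frequencies `k ∈ ℤ²` with `|k|_∞ ≤ N`. -/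
def freqBox (N : ℕ) : Finset (Fin 2 → ℤ) :=
  Finset.Icc (fun _ => -(N : ℤ)) (fun _ => (N : ℤ))

/-- The space `X_N` of real trigonometric polynomials with frequencies `|k|_∞ ≤ N`. -/
def trigSpace (N : ℕ) : Submodule ℝ ((Fin 2 → ℝ) → ℝ) :=
  Submodule.span ℝ
    {g | ∃ k ∈ freqBox N, g = (fun x => Real.cos (phase k x)) ∨ g = (fun x => Real.sin (phase k x))}

/-- The Fourier truncation `Π_N f (x) = (2π)⁻² ∑_{|k|_∞ ≤ N} f̂(k) e^{i k·x}`. For real `f` the sum is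
real, because the frequency box is symmetric; the real part only serves to land in `ℝ`. -/
def fourierTrunc (N : ℕ) (f : (Fin 2 → ℝ) → ℝ) (x : Fin 2 → ℝ) : ℝ :=
  (1 / (2 * (Real.pi : ℂ)) ^ 2 *
    ∑ k ∈ freqBox N, torusFourierCoeff f k * Complex.exp (Complex.I * (phase k x : ℂ))).re

/-- The partial derivative `∂_j f`. -/
def partialD (j : Fin 2) (f : (Fin 2 → ℝ) → ℝ) (x : Fin 2 → ℝ) : ℝ :=
  fderiv ℝ f x (Pi.single j 1)

/-- The Laplacian `Δ f`. -/
def laplace (f : (Fin 2 → ℝ) → ℝ) (x : Fin 2 → ℝ) : ℝ :=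
  ∑ j, partialD j (partialD j f) x

/-- The `i`-th component of a vector field. -/
def component (u : (Fin 2 → ℝ) → Fin 2 → ℝ) (i : Fin 2) : (Fin 2 → ℝ) → ℝ := fun x => u x i

/-- The divergence `∇ · u`. -/
def divergence (u : (Fin 2 → ℝ) → Fin 2 → ℝ) (x : Fin 2 → ℝ) : ℝ :=
  ∑ j, partialD j (component u j) x

/-- The `i`-th component of the convective term `(u · ∇) v`. -/
def convect (u v : (Fin 2 → ℝ) → Fin 2 → ℝ) (i : Fin 2) (x : Fin 2 → ℝ) : ℝ :=
  ∑ j, u x j * partialD j (component v i) x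

/-- `‖∇u‖_{L²(𝕋²)}`. -/
def gradL2Norm (u : (Fin 2 → ℝ) → Fin 2 → ℝ) : ℝ :=
  Real.sqrt (∑ i, ∑ j, ∫ x in torusCell, (partialD j (component u i) x) ^ 2)

/-- `u ∈ H^s(𝕋²; ℝ²)`: each component is a square integrable function on `𝕋²` with
`∑_k (1 + |k|^{2s}) |û(k)|² < ∞`. -/
def MemHs (s : ℝ) (u : (Fin 2 → ℝ) → Fin 2 → ℝ) : Prop :=
  ∀ i, IsPeriodic (component u i) ∧
    MemLp (component u i) 2 (volume.restrict torusCell) ∧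
    Summable fun k : Fin 2 → ℤ =>
      (1 + freqNorm k ^ (2 * s)) * ‖torusFourierCoeff (component u i) k‖ ^ 2

/-- `‖u‖_{H^s} = (2π)⁻¹ (∑_k (1 + |k|^{2s}) |û(k)|²)^{1/2}` for a vector field on `𝕋²`. -/
def hsNorm (s : ℝ) (u : (Fin 2 → ℝ) → Fin 2 → ℝ) : ℝ :=
  1 / (2 * Real.pi) * Real.sqrt (∑ i, ∑' k : Fin 2 → ℤ,
    (1 + freqNorm k ^ (2 * s)) * ‖torusFourierCoeff (component u i) k‖ ^ 2)

/-- `∇ · u = 0` in the weak sense on `𝕋²`. -/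
def WeakDivFree (u : (Fin 2 → ℝ) → Fin 2 → ℝ) : Prop :=
  ∀ φ : (Fin 2 → ℝ) → ℝ, ContDiff ℝ (⊤ : ℕ∞) φ → IsPeriodic φ →
    ∑ j, ∫ x in torusCell, u x j * partialD j φ x = 0

/-- The sequence `u⁰, u¹, u², …` is produced by the semi-implicit Fourier spectral scheme
`(u^{n+1} - u^n)/τ + Π_N(u^n · ∇ u^{n+1}) + ∇ p^n = ν Δ u^{n+1}`, `∇ · u^{n+1} = 0`,
`u^0 = Π_N u_0` in `X_N`. The pressure is sought in `X_N`, which is no restriction: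
by the equation `∇ p^n` has components in `X_N`. -/
structure IsSemiImplicitScheme (N : ℕ) (τ ν : ℝ) (u₀ : (Fin 2 → ℝ) → Fin 2 → ℝ)
    (u : ℕ → (Fin 2 → ℝ) → Fin 2 → ℝ) : Prop where
  mem : ∀ n i, component (u n) i ∈ trigSpace N
  init : ∀ x i, u 0 x i = fourierTrunc N (component u₀ i) x
  div_free : ∀ n x, divergence (u (n + 1)) x = 0
  step : ∀ n, ∃ p ∈ trigSpace N, ∀ x i,
    (u (n + 1) x i - u n x i) / τ + fourierTrunc N (convect (u n) (u (n + 1)) i) x + partialD i p x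
      = ν * laplace (component (u (n + 1)) i) x

end

/-! In Fourier coefficients every nonlinear term becomes a sum over triads p + q + r = 0 in the
frequency box. Write u for the old step, v for the new one, and b(u, v, w) for the trilinear form of
(u · ∇)v against w. Testing the step with v under a weight m (`IsModeStep.energy_le`) produces the
increment, the dissipation and one trilinear term; the pressure disappears because test modes are
orthogonal to their frequency.

The enstrophy argument (m = |k|²) rests on the two-dimensional cancellation b(v, v, Δv) = 0
(`triadSum_enstrophy_eq_zero`). It replaces the transporting field u by -(v - u). Testing the step
with v - u itself gives ‖v - u‖ ≤ τ(K‖u‖ + ν)‖Δv‖ in L², with ‖u‖ the H^s norm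
(`IsModeStep.increment_le`). The trilinear term is then at most τ(K‖u‖ + ν)K‖v‖ · ‖Δv‖², and the
dissipation ν‖Δv‖² absorbs it as soon as the prefactor is at most ν (`IsModeStep.enstrophy_le`).

The prefactor is controlled by an H^s bound on all steps used, uniform in N and ν. For m = 1 +
|k|^{2s} a commutator estimate (`norm_triadSum_sobolev_le`) bounds the trilinear term by a constant
times ‖u‖‖v‖². Dropping the viscosity leaves a discrete Riccati inequality, and a bootstrap
(`sqrt_le_two_mul_of_riccati`) keeps the norm below twice its initial bound for times up to order
1/‖u₀‖. For the H¹ norm, the L² part decreases as well, since transport by a divergence free field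
is skew (`IsModeStep.l2_le`). -/

/-! ### Fourier modes and their orthogonality on the torus. -/

/-- The Fourier mode `e^{i k·x}`. -/
noncomputable def fourierMode (k : Fin 2 → ℤ) (x : Fin 2 → ℝ) : ℂ :=
  Complex.exp (Complex.I * (phase k x : ℂ))

lemma phase_add (k l : Fin 2 → ℤ) (x : Fin 2 → ℝ) : phase (k + l) x = phase k x + phase l x := by
  simp [phase, Fin.sum_univ_two]; ring

lemma phase_neg (k : Fin 2 → ℤ) (x : Fin 2 → ℝ) : phase (-k) x = -phase k x := by
  simp [phase, Fin.sum_univ_two]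

lemma continuous_phase (k : Fin 2 → ℤ) : Continuous (phase k) := by
  unfold phase; fun_prop

lemma fourierMode_add (k l : Fin 2 → ℤ) (x : Fin 2 → ℝ) :
    fourierMode (k + l) x = fourierMode k x * fourierMode l x := by
  rw [fourierMode, fourierMode, fourierMode, ← Complex.exp_add, phase_add]
  push_cast; rw [mul_add]

lemma conj_fourierMode (k : Fin 2 → ℤ) (x : Fin 2 → ℝ) :
    (starRingEnd ℂ) (fourierMode k x) = fourierMode (-k) x := by
  rw [fourierMode, fourierMode, ← Complex.exp_conj, phase_neg]
  simp

lemma continuous_fourierMode (k : Fin 2 → ℤ) : Continuous (fourierMode k) := by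
  have := continuous_phase k
  unfold fourierMode; fun_prop

lemma exp_neg_phase (k : Fin 2 → ℤ) (x : Fin 2 → ℝ) :
    Complex.exp (-(Complex.I * (phase k x : ℂ))) = fourierMode (-k) x := by
  simp [fourierMode, phase_neg]

lemma integral_Icc_exp (m : ℤ) :
    ∫ t in Set.Icc (0 : ℝ) (2 * Real.pi), Complex.exp (Complex.I * ((m : ℝ) * t : ℝ)) =
      if m = 0 then 2 * (Real.pi : ℂ) else 0 := by
  rw [integral_Icc_eq_integral_Ioc, ← intervalIntegral.integral_of_le (by positivity)]
  split_ifs with h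
  · subst h; simp
  · have hc : Complex.I * (m : ℂ) ≠ 0 := by simp [h]
    have := integral_exp_mul_complex (a := 0) (b := 2 * Real.pi) hc
    have e : ∀ t : ℝ, Complex.I * ((m : ℝ) * t : ℝ) = Complex.I * (m : ℂ) * t := by
      intro t; push_cast; ring
    simp only [e]
    rw [this]
    have h1 : Complex.exp (Complex.I * (m : ℂ) * ((2 * Real.pi : ℝ) : ℂ)) = 1 := by
      rw [Complex.exp_eq_one_iff]
      exact ⟨m, by push_cast; ring⟩
    rw [h1]; simp

lemma volume_restrict_torusCell : (volume.restrict torusCell : Measure (Fin 2 → ℝ)) =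
    Measure.pi fun _ : Fin 2 => volume.restrict (Set.Icc (0 : ℝ) (2 * Real.pi)) := by
  rw [torusCell, ← Set.pi_univ_Icc, volume_pi, Measure.restrict_pi_pi]

lemma integral_fourierMode (k : Fin 2 → ℤ) :
    ∫ x in torusCell, fourierMode k x = if k = 0 then (2 * (Real.pi : ℂ)) ^ 2 else 0 := by
  have e : ∀ x, fourierMode k x =
      ∏ j, (fun t : ℝ => Complex.exp (Complex.I * (((k j : ℤ) : ℝ) * t : ℝ))) (x j) := by
    intro x
    rw [← Complex.exp_sum, ← Finset.mul_sum, fourierMode, phase]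
    push_cast; rfl
  simp only [e]
  rw [volume_restrict_torusCell,
    integral_fintype_prod_eq_prod
      (f := fun j (t : ℝ) => Complex.exp (Complex.I * (((k j : ℤ) : ℝ) * t : ℝ)))]
  simp only [integral_Icc_exp, Fin.prod_univ_two]
  by_cases h : k = 0
  · subst h; simp; ring
  · rw [if_neg h]
    have : k 0 ≠ 0 ∨ k 1 ≠ 0 := by
      by_contra! hc
      exact h (by ext j; fin_cases j <;> simp [hc.1, hc.2])
    rcases this with h | h <;> simp [h]

lemma Continuous.integrableOn_torusCell {f : (Fin 2 → ℝ) → ℂ} (hf : Continuous f) :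
    IntegrableOn f torusCell :=
  hf.continuousOn.integrableOn_compact isCompact_Icc

/-- The normalised Fourier coefficient. -/
noncomputable def modeCoeff (f : (Fin 2 → ℝ) → ℝ) (k : Fin 2 → ℤ) : ℂ :=
  1 / (2 * (Real.pi : ℂ)) ^ 2 * torusFourierCoeff f k

lemma two_pi_sq_ne_zero : (2 * (Real.pi : ℂ)) ^ 2 ≠ 0 := by
  simp [Real.pi_ne_zero]

lemma modeCoeff_neg_freq (f : (Fin 2 → ℝ) → ℝ) (k : Fin 2 → ℤ) :
    modeCoeff f (-k) = (starRingEnd ℂ) (modeCoeff f k) := by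
  simp only [modeCoeff, torusFourierCoeff, exp_neg_phase, map_mul, ← integral_conj,
    conj_fourierMode, Complex.conj_ofReal, map_div₀, map_pow, map_one, map_ofNat]

/-! ### Calculus of trigonometric polynomials through their coefficients. -/

/-- `f` is the trigonometric polynomial `∑ c(k) e^{i k·x}` over `|k|_∞ ≤ N`. -/
def HasModes (N : ℕ) (f : (Fin 2 → ℝ) → ℝ) (c : (Fin 2 → ℤ) → ℂ) : Prop :=
  ∀ x, (f x : ℂ) = ∑ k ∈ freqBox N, c k * fourierMode k x

lemma neg_mem_freqBox {N : ℕ} {k : Fin 2 → ℤ} : -k ∈ freqBox N ↔ k ∈ freqBox N := by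
  simp only [freqBox, Finset.mem_Icc, Pi.le_def, Pi.neg_apply]
  constructor
  · rintro ⟨h1, h2⟩; exact ⟨fun i => by linarith [h2 i], fun i => by linarith [h1 i]⟩
  · rintro ⟨h1, h2⟩; exact ⟨fun i => by linarith [h2 i], fun i => by linarith [h1 i]⟩

/-- Orthogonality of the modes. This is what permits comparing coefficients in the scheme and in the
divergence constraint. -/
lemma HasModes.modeCoeff_eq {N : ℕ} {f : (Fin 2 → ℝ) → ℝ} {c : (Fin 2 → ℤ) → ℂ}
    (h : HasModes N f c) (k : Fin 2 → ℤ) :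
    modeCoeff f k = if k ∈ freqBox N then c k else 0 := by
  have e : torusFourierCoeff f k =
      ∑ l ∈ freqBox N, c l * ∫ x in torusCell, fourierMode (l + -k) x := by
    rw [torusFourierCoeff]
    have : ∀ x, (f x : ℂ) * Complex.exp (-(Complex.I * (phase k x : ℂ))) =
        ∑ l ∈ freqBox N, c l * fourierMode (l + -k) x := by
      intro x
      rw [exp_neg_phase, h x, Finset.sum_mul]
      exact Finset.sum_congr rfl fun l _ => by rw [fourierMode_add]; ring
    simp only [this]
    rw [integral_finsetSum]
    · simp only [integral_const_mul]
    · intro l _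
      exact ((continuous_fourierMode _).integrableOn_torusCell).const_mul _
  rw [modeCoeff, e]
  simp only [integral_fourierMode, ← sub_eq_add_neg, sub_eq_zero, mul_ite, mul_zero]
  rw [Finset.sum_ite_eq']
  split_ifs
  · field_simp [two_pi_sq_ne_zero]
  · simp

lemma HasModes.self {N : ℕ} {f : (Fin 2 → ℝ) → ℝ} {c : (Fin 2 → ℤ) → ℂ}
    (h : HasModes N f c) : HasModes N f (modeCoeff f) := by
  intro x
  rw [h x]
  exact Finset.sum_congr rfl fun k hk => by rw [h.modeCoeff_eq, if_pos hk]

lemma HasModes.unique {N : ℕ} {f : (Fin 2 → ℝ) → ℝ} {c d : (Fin 2 → ℤ) → ℂ}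
    (h : HasModes N f c) (h' : HasModes N f d) {k : Fin 2 → ℤ} (hk : k ∈ freqBox N) :
    c k = d k := by
  have h1 := h.modeCoeff_eq k
  have h2 := h'.modeCoeff_eq k
  rw [if_pos hk] at h1 h2
  exact h1.symm.trans h2

lemma HasModes.add {N : ℕ} {f g : (Fin 2 → ℝ) → ℝ} {c d : (Fin 2 → ℤ) → ℂ}
    (h : HasModes N f c) (h' : HasModes N g d) :
    HasModes N (fun x => f x + g x) (fun k => c k + d k) := by
  intro x
  push_cast
  rw [h x, h' x, ← Finset.sum_add_distrib]
  exact Finset.sum_congr rfl fun k _ => by ring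

lemma HasModes.const_mul {N : ℕ} {f : (Fin 2 → ℝ) → ℝ} {c : (Fin 2 → ℤ) → ℂ}
    (h : HasModes N f c) (a : ℝ) : HasModes N (fun x => a * f x) (fun k => a * c k) := by
  intro x
  push_cast
  rw [h x, Finset.mul_sum]
  exact Finset.sum_congr rfl fun k _ => by ring

lemma HasModes.sub {N : ℕ} {f g : (Fin 2 → ℝ) → ℝ} {c d : (Fin 2 → ℤ) → ℂ}
    (h : HasModes N f c) (h' : HasModes N g d) :
    HasModes N (fun x => f x - g x) (fun k => c k - d k) := by
  intro x
  push_cast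
  rw [h x, h' x, ← Finset.sum_sub_distrib]
  exact Finset.sum_congr rfl fun k _ => by ring

lemma hasModes_zero (N : ℕ) : HasModes N (fun _ => 0) (fun _ => 0) := by
  intro x; simp

lemma fourierMode_eq_cos_add_sin (k : Fin 2 → ℤ) (x : Fin 2 → ℝ) :
    fourierMode k x = (Real.cos (phase k x) : ℂ) + (Real.sin (phase k x) : ℂ) * Complex.I := by
  rw [fourierMode, mul_comm, Complex.exp_mul_I]; push_cast; rfl

lemma hasModes_cos {N : ℕ} {k : Fin 2 → ℤ} (hk : k ∈ freqBox N) :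
    HasModes N (fun x => Real.cos (phase k x))
      (fun l => (if l = k then 1 / 2 else 0) + (if l = -k then 1 / 2 else 0)) := by
  intro x
  simp only [add_mul, ite_mul, zero_mul, Finset.sum_add_distrib, Finset.sum_ite_eq', hk,
    neg_mem_freqBox, if_true]
  rw [fourierMode_eq_cos_add_sin, fourierMode_eq_cos_add_sin, phase_neg, Real.cos_neg,
    Real.sin_neg]
  push_cast; ring

lemma hasModes_sin {N : ℕ} {k : Fin 2 → ℤ} (hk : k ∈ freqBox N) :
    HasModes N (fun x => Real.sin (phase k x))
      (fun l => (if l = k then -Complex.I / 2 else 0) + (if l = -k then Complex.I / 2 else 0)) := by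
  intro x
  simp only [add_mul, ite_mul, zero_mul, Finset.sum_add_distrib, Finset.sum_ite_eq', hk,
    neg_mem_freqBox, if_true]
  rw [fourierMode_eq_cos_add_sin, fourierMode_eq_cos_add_sin, phase_neg, Real.cos_neg,
    Real.sin_neg]
  push_cast; ring_nf; simp

lemma hasModes_of_mem_trigSpace {N : ℕ} {f : (Fin 2 → ℝ) → ℝ} (hf : f ∈ trigSpace N) :
    HasModes N f (modeCoeff f) := by
  suffices ∃ c, HasModes N f c from this.choose_spec.self
  refine Submodule.span_induction (p := fun f _ => ∃ c, HasModes N f c) ?_ ?_ ?_ ?_ hf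
  · rintro g ⟨k, hk, rfl | rfl⟩
    · exact ⟨_, hasModes_cos hk⟩
    · exact ⟨_, hasModes_sin hk⟩
  · exact ⟨_, hasModes_zero N⟩
  · rintro f g _ _ ⟨c, hc⟩ ⟨d, hd⟩
    exact ⟨_, hc.add hd⟩
  · rintro a f _ ⟨c, hc⟩
    exact ⟨_, hc.const_mul a⟩

lemma hasFDerivAt_fourierMode (k : Fin 2 → ℤ) (x : Fin 2 → ℝ) :
    ∃ L : (Fin 2 → ℝ) →L[ℝ] ℂ, HasFDerivAt (fourierMode k) L x ∧
      ∀ j, L (Pi.single j 1) = Complex.I * k j * fourierMode k x := by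
  have h1 : HasFDerivAt (phase k)
      (∑ j, (k j : ℝ) • ContinuousLinearMap.proj (R := ℝ) (φ := fun _ : Fin 2 => ℝ) j) x := by
    unfold phase
    refine HasFDerivAt.fun_sum fun j _ => ?_
    exact (hasFDerivAt_apply j x).const_mul _
  have h2 := ((Complex.ofRealCLM.hasFDerivAt.comp x h1).const_mul Complex.I).cexp
  refine ⟨_, h2, fun j => ?_⟩
  fin_cases j <;> simp [fourierMode] <;> ring

lemma HasModes.hasFDerivAt {N : ℕ} {f : (Fin 2 → ℝ) → ℝ} {c : (Fin 2 → ℤ) → ℂ}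
    (h : HasModes N f c) (x : Fin 2 → ℝ) :
    DifferentiableAt ℝ f x ∧ ∀ j, ((partialD j f x : ℝ) : ℂ) =
      ∑ k ∈ freqBox N, (Complex.I * k j * c k) * fourierMode k x := by
  choose L hL hLj using fun k => hasFDerivAt_fourierMode k x
  have hF : HasFDerivAt (fun x => (f x : ℂ)) (∑ k ∈ freqBox N, c k • L k) x := by
    have e : (fun x => (f x : ℂ)) = fun x => ∑ k ∈ freqBox N, c k * fourierMode k x := funext h
    rw [e]
    exact HasFDerivAt.fun_sum fun k _ => (hL k).const_mul (c k)
  -- Differentiability of the real function comes first, since `fderiv` is 0 by default; its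
  -- derivative is then identified inside ℂ by uniqueness.
  have hf : DifferentiableAt ℝ f x := (Complex.reCLM.hasFDerivAt.comp x hF).differentiableAt
  refine ⟨hf, fun j => ?_⟩
  have h3 := (Complex.ofRealCLM.hasFDerivAt.comp x hf.hasFDerivAt).unique hF
  have h4 := congrArg (fun A : (Fin 2 → ℝ) →L[ℝ] ℂ => A (Pi.single j 1)) h3
  simp only [ContinuousLinearMap.comp_apply, Complex.ofRealCLM_apply, sum_apply,
    smul_apply, hLj, smul_eq_mul] at h4
  rw [partialD, h4]
  exact Finset.sum_congr rfl fun k _ => by ring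

lemma HasModes.partialD {N : ℕ} {f : (Fin 2 → ℝ) → ℝ} {c : (Fin 2 → ℤ) → ℂ}
    (h : HasModes N f c) (j : Fin 2) :
    HasModes N (partialD j f) (fun k => Complex.I * k j * c k) :=
  fun x => (h.hasFDerivAt x).2 j

lemma HasModes.laplace {N : ℕ} {f : (Fin 2 → ℝ) → ℝ} {c : (Fin 2 → ℤ) → ℂ}
    (h : HasModes N f c) :
    HasModes N (laplace f) (fun k => -((∑ j, (k j : ℂ) ^ 2) * c k)) := by
  intro x
  simp only [_root_.laplace, Fin.sum_univ_two]
  push_cast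
  rw [(h.partialD 0).partialD 0 x, (h.partialD 1).partialD 1 x, ← Finset.sum_add_distrib]
  refine Finset.sum_congr rfl fun k _ => ?_
  ring_nf
  simp only [Complex.I_sq]; ring

lemma hasModes_fourierTrunc (N : ℕ) (f : (Fin 2 → ℝ) → ℝ) :
    HasModes N (fourierTrunc N f) (modeCoeff f) := by
  intro x
  have e : 1 / (2 * (Real.pi : ℂ)) ^ 2 *
      ∑ k ∈ freqBox N, torusFourierCoeff f k * Complex.exp (Complex.I * (phase k x : ℂ)) =
      ∑ k ∈ freqBox N, modeCoeff f k * fourierMode k x := by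
    rw [Finset.mul_sum]
    exact Finset.sum_congr rfl fun k _ => by rw [modeCoeff, fourierMode]; ring
  rw [fourierTrunc, e]
  -- The real part loses nothing: k ↦ -k preserves the box and conjugates each term.
  apply Complex.conj_eq_iff_re.mp
  rw [map_sum]
  refine Finset.sum_nbij' (fun k => -k) (fun k => -k) ?_ ?_ ?_ ?_ ?_
  · intro k hk; exact neg_mem_freqBox.mpr hk
  · intro k hk; exact neg_mem_freqBox.mpr hk
  · intro k _; simp
  · intro k _; simp
  · intro k _
    rw [map_mul, conj_fourierMode, modeCoeff_neg_freq]

/-- A product becomes a convolution. The sum over j fits (u · ∇)v, and a one-element index gives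
Parseval. -/
lemma modeCoeff_sum_mul {ι : Type*} [Fintype ι] {N : ℕ} {f g : ι → (Fin 2 → ℝ) → ℝ}
    {c d : ι → (Fin 2 → ℤ) → ℂ} (hf : ∀ j, HasModes N (f j) (c j)) (hg : ∀ j, HasModes N (g j) (d j))
    (k : Fin 2 → ℤ) :
    modeCoeff (fun x => ∑ j, f j x * g j x) k =
      ∑ p ∈ freqBox N, ∑ q ∈ freqBox N, if p + q = k then ∑ j, c j p * d j q else 0 := by
  have e : torusFourierCoeff (fun x => ∑ j, f j x * g j x) k =
      ∑ p ∈ freqBox N, ∑ q ∈ freqBox N,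
        (∑ j, c j p * d j q) * ∫ x in torusCell, fourierMode (p + q + -k) x := by
    rw [torusFourierCoeff]
    have : ∀ x, ((∑ j, f j x * g j x : ℝ) : ℂ) * Complex.exp (-(Complex.I * (phase k x : ℂ))) =
        ∑ p ∈ freqBox N, ∑ q ∈ freqBox N,
          (∑ j, c j p * d j q) * fourierMode (p + q + -k) x := by
      intro x
      have h1 : ∀ j, ((f j x * g j x : ℝ) : ℂ) * fourierMode (-k) x =
          ∑ p ∈ freqBox N, ∑ q ∈ freqBox N, c j p * d j q * fourierMode (p + q + -k) x := by
        intro j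
        rw [Complex.ofReal_mul, hf j x, hg j x, Finset.sum_mul_sum, Finset.sum_mul]
        refine Finset.sum_congr rfl fun p _ => ?_
        rw [Finset.sum_mul]
        refine Finset.sum_congr rfl fun q _ => ?_
        rw [fourierMode_add, fourierMode_add]; ring
      rw [exp_neg_phase, Complex.ofReal_sum, Finset.sum_mul]
      simp only [h1]
      rw [Finset.sum_comm]
      refine Finset.sum_congr rfl fun p _ => ?_
      rw [Finset.sum_comm]
      exact Finset.sum_congr rfl fun q _ => (Finset.sum_mul _ _ _).symm
    simp only [this]
    have hi : ∀ (a : ℂ) l, IntegrableOn (fun x => a * fourierMode l x) torusCell := fun a l =>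
      ((continuous_fourierMode l).integrableOn_torusCell).const_mul a
    rw [integral_finsetSum]
    · refine Finset.sum_congr rfl fun p _ => ?_
      rw [integral_finsetSum]
      · simp only [integral_const_mul]
      · exact fun q _ => hi _ _
    · exact fun p _ => integrable_finsetSum _ fun q _ => hi _ _
  rw [modeCoeff, e, Finset.mul_sum]
  refine Finset.sum_congr rfl fun p _ => ?_
  rw [Finset.mul_sum]
  refine Finset.sum_congr rfl fun q _ => ?_
  rw [integral_fourierMode]
  simp only [← sub_eq_add_neg, sub_eq_zero]
  split_ifs
  · field_simp [two_pi_sq_ne_zero]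
  · simp

lemma HasModes.integral_sq {N : ℕ} {f : (Fin 2 → ℝ) → ℝ} {c : (Fin 2 → ℤ) → ℂ}
    (h : HasModes N f c) :
    ∫ x in torusCell, f x ^ 2 = (2 * Real.pi) ^ 2 * ∑ k ∈ freqBox N, ‖c k‖ ^ 2 := by
  -- Parseval is the zero mode of f · f. The second copy carries `modeCoeff f`, whose conjugate
  -- symmetry turns the product at p and -p into a squared modulus.
  have h0 := modeCoeff_sum_mul (ι := Unit) (fun _ => h) (fun _ => h.self) 0
  simp only [Finset.univ_unique, Finset.sum_singleton] at h0
  have h1 : modeCoeff (fun x => f x * f x) 0 =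
      1 / (2 * (Real.pi : ℂ)) ^ 2 * ((∫ x in torusCell, f x ^ 2 : ℝ) : ℂ) := by
    rw [modeCoeff, torusFourierCoeff, ← integral_complex_ofReal]
    simp [phase, sq]
  have h2 : (∑ p ∈ freqBox N, ∑ q ∈ freqBox N, if p + q = 0 then c p * modeCoeff f q else 0) =
      ((∑ k ∈ freqBox N, ‖c k‖ ^ 2 : ℝ) : ℂ) := by
    push_cast
    refine Finset.sum_congr rfl fun p hp => ?_
    have : ∀ q, p + q = 0 ↔ q = -p := fun q => by
      rw [add_comm]; exact add_eq_zero_iff_eq_neg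
    simp only [this]
    rw [Finset.sum_ite_eq', if_pos (neg_mem_freqBox.mpr hp), modeCoeff_neg_freq,
      h.modeCoeff_eq, if_pos hp, Complex.mul_conj, Complex.normSq_eq_norm_sq]
    push_cast; rfl
  rw [h1, h2, one_div, inv_mul_eq_iff_eq_mul₀ two_pi_sq_ne_zero] at h0
  exact_mod_cast h0

/-! ### Triad sums: symmetries and convolution bound. -/

/-- The sum of `F p q r` over the triads `p + q + r = 0` in `B`. -/
def triadSum {R : Type*} [AddCommMonoid R] (B : Finset (Fin 2 → ℤ))
    (F : (Fin 2 → ℤ) → (Fin 2 → ℤ) → (Fin 2 → ℤ) → R) : R :=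
  ∑ p ∈ B, ∑ q ∈ B, ∑ r ∈ B, if p + q + r = 0 then F p q r else 0

/-- The bilinear product `a · k` of a complex vector with a frequency. -/
def freqDot (a : Fin 2 → ℂ) (k : Fin 2 → ℤ) : ℂ := ∑ j, a j * k j

/-- The bilinear product of two complex vectors. -/
def bilinDot (a b : Fin 2 → ℂ) : ℂ := ∑ j, a j * b j

/-- The Hermitian length of a complex vector. -/
noncomputable def amplitude (a : Fin 2 → ℂ) : ℝ := Real.sqrt (∑ j, ‖a j‖ ^ 2)

section Triads

variable {R : Type*} (B : Finset (Fin 2 → ℤ))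

lemma triadSum_congr [AddCommMonoid R] {F G : (Fin 2 → ℤ) → (Fin 2 → ℤ) → (Fin 2 → ℤ) → R}
    (h : ∀ p q r, p + q + r = 0 → F p q r = G p q r) : triadSum B F = triadSum B G := by
  refine Finset.sum_congr rfl fun p _ => Finset.sum_congr rfl fun q _ =>
    Finset.sum_congr rfl fun r _ => ?_
  split_ifs with hp
  · exact h p q r hp
  · rfl

lemma triadSum_swap_left [AddCommMonoid R] (F : (Fin 2 → ℤ) → (Fin 2 → ℤ) → (Fin 2 → ℤ) → R) :
    triadSum B F = triadSum B fun p q r => F q p r := by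
  unfold triadSum
  rw [Finset.sum_comm]
  refine Finset.sum_congr rfl fun p _ => Finset.sum_congr rfl fun q _ =>
    Finset.sum_congr rfl fun r _ => ?_
  rw [add_comm p q]

lemma triadSum_swap_right [AddCommMonoid R] (F : (Fin 2 → ℤ) → (Fin 2 → ℤ) → (Fin 2 → ℤ) → R) :
    triadSum B F = triadSum B fun p q r => F p r q := by
  unfold triadSum
  refine Finset.sum_congr rfl fun p _ => ?_
  rw [Finset.sum_comm]
  refine Finset.sum_congr rfl fun q _ => Finset.sum_congr rfl fun r _ => ?_
  rw [add_right_comm]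

lemma triadSum_add [AddCommMonoid R] (F G : (Fin 2 → ℤ) → (Fin 2 → ℤ) → (Fin 2 → ℤ) → R) :
    triadSum B (fun p q r => F p q r + G p q r) = triadSum B F + triadSum B G := by
  simp only [triadSum, ← Finset.sum_add_distrib]
  refine Finset.sum_congr rfl fun p _ => Finset.sum_congr rfl fun q _ =>
    Finset.sum_congr rfl fun r _ => ?_
  split_ifs <;> simp

lemma triadSum_neg [AddCommGroup R] (F : (Fin 2 → ℤ) → (Fin 2 → ℤ) → (Fin 2 → ℤ) → R) :
    triadSum B (fun p q r => -F p q r) = -triadSum B F := by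
  simp only [triadSum, ← Finset.sum_neg_distrib]
  refine Finset.sum_congr rfl fun p _ => Finset.sum_congr rfl fun q _ =>
    Finset.sum_congr rfl fun r _ => ?_
  split_ifs <;> simp

lemma triadSum_sub [AddCommGroup R] (F G : (Fin 2 → ℤ) → (Fin 2 → ℤ) → (Fin 2 → ℤ) → R) :
    triadSum B (fun p q r => F p q r - G p q r) = triadSum B F - triadSum B G := by
  simp only [sub_eq_add_neg, triadSum_add, triadSum_neg]

lemma triadSum_mul_left (c : ℝ) (F : (Fin 2 → ℤ) → (Fin 2 → ℤ) → (Fin 2 → ℤ) → ℝ) :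
    triadSum B (fun p q r => c * F p q r) = c * triadSum B F := by
  simp only [triadSum, Finset.mul_sum, mul_ite, mul_zero]

lemma norm_triadSum_le {F : (Fin 2 → ℤ) → (Fin 2 → ℤ) → (Fin 2 → ℤ) → ℂ}
    {G : (Fin 2 → ℤ) → (Fin 2 → ℤ) → (Fin 2 → ℤ) → ℝ}
    (h : ∀ p q r, p + q + r = 0 → ‖F p q r‖ ≤ G p q r) : ‖triadSum B F‖ ≤ triadSum B G := by
  refine (norm_sum_le _ _).trans (Finset.sum_le_sum fun p _ => ?_)
  refine (norm_sum_le _ _).trans (Finset.sum_le_sum fun q _ => ?_)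
  refine (norm_sum_le _ _).trans (Finset.sum_le_sum fun r _ => ?_)
  split_ifs with hp
  · exact h p q r hp
  · simp

lemma triadSum_eq_zero_of_antisymm {F : (Fin 2 → ℤ) → (Fin 2 → ℤ) → (Fin 2 → ℤ) → ℂ}
    (h : ∀ p q r, p + q + r = 0 → F p r q = -F p q r) : triadSum B F = 0 := by
  have h1 := triadSum_swap_right B F
  rw [triadSum_congr B (G := fun p q r => -F p q r) h, triadSum_neg] at h1
  exact self_eq_neg.mp h1

/-- The constraint p + q + r = 0 and the box are invariant under all six permutations, so the sum
equals its average over them. -/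
lemma triadSum_eq_zero_of_symmetrization {F : (Fin 2 → ℤ) → (Fin 2 → ℤ) → (Fin 2 → ℤ) → ℂ}
    (h : ∀ p q r, p + q + r = 0 →
      F p q r + F p r q + F q p r + F q r p + F r p q + F r q p = 0) : triadSum B F = 0 := by
  have e0 := triadSum_congr B h
  have z : triadSum B (fun _ _ _ => (0 : ℂ)) = 0 := by simp [triadSum]
  simp only [triadSum_add, z] at e0
  have e1 : triadSum B (fun p q r => F p r q) = triadSum B F := (triadSum_swap_right B F).symm
  have e2 : triadSum B (fun p q r => F q p r) = triadSum B F := (triadSum_swap_left B F).symm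
  have e3 : triadSum B (fun p q r => F q r p) = triadSum B F :=
    (triadSum_swap_left B fun p q r => F q r p).trans e1
  have e4 : triadSum B (fun p q r => F r p q) = triadSum B F :=
    (triadSum_swap_right B fun p q r => F r p q).trans e2
  have e5 : triadSum B (fun p q r => F r q p) = triadSum B F :=
    (triadSum_swap_left B fun p q r => F r q p).trans e4
  have e6 : triadSum B (fun p q r => F p q r) = triadSum B F := rfl
  rw [e1, e2, e3, e4, e5, e6] at e0
  linear_combination e0 / 6

/-- Young's convolution inequality `ℓ¹ * ℓ² * ℓ² → ℝ`. -/
lemma triadSum_mul_le {a b c : (Fin 2 → ℤ) → ℝ} (ha : ∀ k, 0 ≤ a k) :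
    triadSum B (fun p q r => a p * b q * c r) ≤
      (∑ k ∈ B, a k) * (Real.sqrt (∑ k ∈ B, b k ^ 2) * Real.sqrt (∑ k ∈ B, c k ^ 2)) := by
  rw [Finset.sum_mul]
  refine Finset.sum_le_sum fun p _ => ?_
  have e : (∑ q ∈ B, ∑ r ∈ B, if p + q + r = 0 then a p * b q * c r else 0) =
      a p * ∑ x ∈ (B ×ˢ B).filter (fun x => p + x.1 + x.2 = 0), b x.1 * c x.2 := by
    rw [Finset.sum_filter, Finset.sum_product, Finset.mul_sum]
    refine Finset.sum_congr rfl fun q _ => ?_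
    rw [Finset.mul_sum]
    refine Finset.sum_congr rfl fun r _ => ?_
    split_ifs
    · ring
    · simp
  rw [e]
  refine mul_le_mul_of_nonneg_left ?_ (ha p)
  -- For fixed p each of q and r determines the other, so Cauchy–Schwarz over the admissible pairs
  -- leaves two unrestricted ℓ² norms.
  refine (Real.sum_mul_le_sqrt_mul_sqrt _ _ _).trans ?_
  refine mul_le_mul (Real.sqrt_le_sqrt ?_) (Real.sqrt_le_sqrt ?_) (Real.sqrt_nonneg _)
    (Real.sqrt_nonneg _)
  · rw [Finset.sum_filter, Finset.sum_product]
    refine Finset.sum_le_sum fun q _ => ?_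
    have : ∀ r, p + q + r = 0 ↔ r = -(p + q) := fun r => by
      rw [add_comm]; exact add_eq_zero_iff_eq_neg
    simp only [this]
    rw [Finset.sum_ite_eq']
    split_ifs
    · rfl
    · positivity
  · rw [Finset.sum_filter, Finset.sum_product, Finset.sum_comm]
    refine Finset.sum_le_sum fun r _ => ?_
    have : ∀ q, p + q + r = 0 ↔ q = -(p + r) := fun q => by
      rw [add_right_comm, add_comm]; exact add_eq_zero_iff_eq_neg
    simp only [this]
    rw [Finset.sum_ite_eq']
    split_ifs
    · rfl
    · positivity

end Triads

/-! ### Lengths of amplitudes and frequencies. -/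

lemma amplitude_nonneg (a : Fin 2 → ℂ) : 0 ≤ amplitude a := Real.sqrt_nonneg _

lemma amplitude_sq (a : Fin 2 → ℂ) : amplitude a ^ 2 = ∑ j, ‖a j‖ ^ 2 :=
  Real.sq_sqrt (by positivity)

lemma freqNorm_nonneg (k : Fin 2 → ℤ) : 0 ≤ freqNorm k := Real.sqrt_nonneg _

lemma freqNorm_sq (k : Fin 2 → ℤ) : freqNorm k ^ 2 = ∑ j, (k j : ℝ) ^ 2 :=
  Real.sq_sqrt (by positivity)

lemma freqNorm_eq_norm (k : Fin 2 → ℤ) :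
    freqNorm k = ‖WithLp.toLp 2 (fun j => (k j : ℝ))‖ := by
  rw [EuclideanSpace.norm_eq, freqNorm]; simp

lemma freqNorm_add_le (k l : Fin 2 → ℤ) : freqNorm (k + l) ≤ freqNorm k + freqNorm l := by
  simp only [freqNorm_eq_norm]
  refine le_trans (le_of_eq ?_) (norm_add_le _ _)
  congr 1
  ext j; simp

lemma freqNorm_neg (k : Fin 2 → ℤ) : freqNorm (-k) = freqNorm k := by
  simp [freqNorm]

lemma one_le_freqNorm {k : Fin 2 → ℤ} (hk : k ≠ 0) : 1 ≤ freqNorm k := by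
  rw [freqNorm, Real.one_le_sqrt]
  have : (1 : ℤ) ≤ ∑ j, k j ^ 2 := by
    rw [Order.one_le_iff_pos]
    obtain ⟨j, hj⟩ := Function.ne_iff.mp hk
    exact Finset.sum_pos' (fun i _ => sq_nonneg _) ⟨j, Finset.mem_univ j, by
      have : k j ≠ 0 := hj
      positivity⟩
  exact_mod_cast this

lemma norm_le_freqNorm (k : Fin 2 → ℤ) : ‖k‖ ≤ freqNorm k := by
  rw [pi_norm_le_iff_of_nonneg (freqNorm_nonneg k)]
  intro j
  rw [Int.norm_eq_abs, freqNorm]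
  exact Real.abs_le_sqrt (Finset.single_le_sum (f := fun j => (k j : ℝ) ^ 2)
    (fun i _ => sq_nonneg _) (Finset.mem_univ j))

lemma norm_freqDot_le (a : Fin 2 → ℂ) (k : Fin 2 → ℤ) :
    ‖freqDot a k‖ ≤ amplitude a * freqNorm k := by
  refine (norm_sum_le _ _).trans ?_
  have h := Real.sum_mul_le_sqrt_mul_sqrt Finset.univ (fun j => ‖a j‖) (fun j => |(k j : ℝ)|)
  simp only [sq_abs] at h
  refine le_trans (le_of_eq (Finset.sum_congr rfl fun j _ => ?_)) h
  rw [norm_mul, Complex.norm_intCast]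

lemma norm_bilinDot_le (a b : Fin 2 → ℂ) :
    ‖bilinDot a b‖ ≤ amplitude a * amplitude b := by
  refine (norm_sum_le _ _).trans ?_
  simp only [norm_mul]
  exact Real.sum_mul_le_sqrt_mul_sqrt Finset.univ _ _

lemma freqDot_add (a : Fin 2 → ℂ) (k l : Fin 2 → ℤ) :
    freqDot a (k + l) = freqDot a k + freqDot a l := by
  simp [freqDot, Fin.sum_univ_two]; ring

lemma bilinDot_comm (a b : Fin 2 → ℂ) : bilinDot a b = bilinDot b a := by
  simp [bilinDot, mul_comm]

lemma freqDot_eq_neg_of_triad {a : Fin 2 → ℂ} {p q r : Fin 2 → ℤ} (h : p + q + r = 0)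
    (ha : freqDot a p = 0) : freqDot a r = -freqDot a q := by
  have h0 : freqDot a (p + q + r) = 0 := by rw [h]; simp [freqDot]
  rw [freqDot_add, freqDot_add, ha] at h0
  linear_combination h0

/-! ### Cancellations of the trilinear form. -/

/-- Transport by a divergence free field is skew-symmetric. -/
lemma triadSum_transport_eq_zero (B : Finset (Fin 2 → ℤ)) {u : (Fin 2 → ℤ) → Fin 2 → ℂ}
    (hu : ∀ k, freqDot (u k) k = 0) (v : (Fin 2 → ℤ) → Fin 2 → ℂ) (m : (Fin 2 → ℤ) → ℂ) :
    triadSum B (fun p q r => m q * m r * (freqDot (u p) q * bilinDot (v q) (v r))) = 0 := by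
  refine triadSum_eq_zero_of_antisymm B fun p q r h => ?_
  rw [freqDot_eq_neg_of_triad h (hu p), bilinDot_comm (v r)]
  ring

/-- The stream function on one mode: in dimension two, the vectors orthogonal to a nonzero p form
the line through its rotation by a right angle. -/
lemma exists_stream {p a : Fin 2 → ℂ} (h : a 0 * p 0 + a 1 * p 1 = 0) :
    p = 0 ∨ ∃ α, a 0 = -(α * p 1) ∧ a 1 = α * p 0 := by
  by_cases h0 : p 0 = 0
  · by_cases h1 : p 1 = 0
    · left; ext j; fin_cases j <;> simp [h0, h1]
    · right
      refine ⟨-(a 0) / p 1, by field_simp, ?_⟩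
      rw [h0] at h ⊢
      simpa [h1] using h
  · right
    refine ⟨a 1 / p 0, ?_, by field_simp⟩
    field_simp
    linear_combination h

/-- In two dimensions the enstrophy transfer cancels on each triad. -/
lemma enstrophy_triad {p q r a b c : Fin 2 → ℂ} (h : p + q + r = 0)
    (ha : a 0 * p 0 + a 1 * p 1 = 0) (hb : b 0 * q 0 + b 1 * q 1 = 0)
    (hc : c 0 * r 0 + c 1 * r 1 = 0) :
    (a 0 * q 0 + a 1 * q 1) * (b 0 * c 0 + b 1 * c 1) * (r 0 ^ 2 + r 1 ^ 2) +
    (a 0 * r 0 + a 1 * r 1) * (c 0 * b 0 + c 1 * b 1) * (q 0 ^ 2 + q 1 ^ 2) +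
    (b 0 * p 0 + b 1 * p 1) * (a 0 * c 0 + a 1 * c 1) * (r 0 ^ 2 + r 1 ^ 2) +
    (b 0 * r 0 + b 1 * r 1) * (c 0 * a 0 + c 1 * a 1) * (p 0 ^ 2 + p 1 ^ 2) +
    (c 0 * p 0 + c 1 * p 1) * (a 0 * b 0 + a 1 * b 1) * (q 0 ^ 2 + q 1 ^ 2) +
    (c 0 * q 0 + c 1 * q 1) * (b 0 * a 0 + b 1 * a 1) * (p 0 ^ 2 + p 1 ^ 2) = 0 := by
  -- If one frequency vanishes, the other two are opposite and the identity is immediate. Otherwise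
  -- the three stream amplitudes reduce it to a polynomial identity in p and q.
  rcases exists_stream ha with rfl | ⟨α, a0, a1⟩
  · obtain rfl : r = -q := by rw [zero_add] at h; exact (neg_eq_of_add_eq_zero_right h).symm
    simp only [Pi.zero_apply, Pi.neg_apply]; ring
  rcases exists_stream hb with rfl | ⟨β, b0, b1⟩
  · obtain rfl : r = -p := by rw [add_zero] at h; exact (neg_eq_of_add_eq_zero_right h).symm
    simp only [Pi.zero_apply, Pi.neg_apply]; ring
  rcases exists_stream hc with rfl | ⟨γ, c0, c1⟩
  · obtain rfl : q = -p := by rw [add_zero] at h; exact (neg_eq_of_add_eq_zero_right h).symm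
    simp only [Pi.zero_apply, Pi.neg_apply]; ring
  obtain rfl : r = -(p + q) := (neg_eq_of_add_eq_zero_right h).symm
  rw [a0, a1, b0, b1, c0, c1]
  simp only [Pi.add_apply, Pi.neg_apply]; ring

lemma triadSum_enstrophy_eq_zero (B : Finset (Fin 2 → ℤ)) {v : (Fin 2 → ℤ) → Fin 2 → ℂ}
    (hv : ∀ k, freqDot (v k) k = 0) :
    triadSum B (fun p q r => ((freqNorm r ^ 2 : ℝ) : ℂ) *
      (freqDot (v p) q * bilinDot (v q) (v r))) = 0 := by
  refine triadSum_eq_zero_of_symmetrization B fun p q r h => ?_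
  have hd : ∀ k, v k 0 * (k 0 : ℂ) + v k 1 * (k 1 : ℂ) = 0 := fun k => by
    simpa [freqDot, Fin.sum_univ_two] using hv k
  have h' : (fun j => (p j : ℂ)) + (fun j => (q j : ℂ)) + (fun j => (r j : ℂ)) = 0 := by
    ext j
    have := congrFun h j
    simp only [Pi.add_apply, Pi.zero_apply] at this ⊢
    exact_mod_cast this
  have e := enstrophy_triad h' (hd p) (hd q) (hd r)
  simp only [freqNorm_sq, freqDot, bilinDot, Fin.sum_univ_two]
  push_cast
  linear_combination e

/-! ### Commutator symbol and the Sobolev embedding. -/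

section Commutator

lemma abs_rpow_sub_rpow_le {s x y : ℝ} (hs : 1 ≤ s) (hx : 0 ≤ x) (hy : 0 ≤ y) :
    |x ^ s - y ^ s| ≤ s * (max x y) ^ (s - 1) * |x - y| := by
  have h := Convex.norm_image_sub_le_of_norm_deriv_le (f := fun t : ℝ => t ^ s)
    (s := Set.Icc 0 (max x y)) (x := y) (y := x) (C := s * (max x y) ^ (s - 1))
    (fun t _ => (Real.hasDerivAt_rpow_const (Or.inr hs)).differentiableAt)
    (fun t ht => by
      rw [(Real.hasDerivAt_rpow_const (Or.inr hs)).deriv, Real.norm_eq_abs,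
        abs_of_nonneg (mul_nonneg (by linarith) (Real.rpow_nonneg ht.1 _))]
      exact mul_le_mul_of_nonneg_left (Real.rpow_le_rpow ht.1 ht.2 (by linarith)) (by linarith))
    (convex_Icc _ _) ⟨hy, le_max_right _ _⟩ ⟨hx, le_max_left _ _⟩
  simpa [Real.norm_eq_abs] using h

/-- Since x ≤ y + d ≤ 2 max(d, y), the mean value bound splits according to which of d and y
dominates. On a triad d = |p|, x = |r| and y = |q|, so the s derivatives either all fall on the
transporting field or leave only one there. -/
lemma abs_rpow_sub_rpow_le_of_abs_sub_le {s x y d : ℝ} (hs : 1 < s) (hx : 0 ≤ x) (hy : 0 ≤ y)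
    (hd : 0 ≤ d) (h : |x - y| ≤ d) :
    |x ^ s - y ^ s| ≤ s * 2 ^ (s - 1) * (d ^ s + d * y ^ (s - 1)) := by
  have hm : max x y ≤ 2 * max d y := by
    have h1 := (abs_le.mp h).2
    have h2 := le_max_left d y
    have h3 := le_max_right d y
    exact max_le (by linarith) (by linarith)
  have hm0 : 0 ≤ max d y := le_max_of_le_left hd
  have h1 : (max x y) ^ (s - 1) ≤ 2 ^ (s - 1) * (d ^ (s - 1) + y ^ (s - 1)) := by
    refine (Real.rpow_le_rpow (le_max_of_le_left hx) hm (by linarith)).trans ?_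
    rw [Real.mul_rpow (by norm_num) hm0]
    refine mul_le_mul_of_nonneg_left ?_ (by positivity)
    rcases max_choice d y with e | e <;> rw [e]
    · linarith [Real.rpow_nonneg hy (s - 1)]
    · linarith [Real.rpow_nonneg hd (s - 1)]
  have h2 : d ^ s = d ^ (s - 1) * d := by
    rw [← Real.rpow_add_one' hd (by linarith)]; ring_nf
  calc |x ^ s - y ^ s| ≤ s * (max x y) ^ (s - 1) * |x - y| := abs_rpow_sub_rpow_le hs.le hx hy
    _ ≤ s * (2 ^ (s - 1) * (d ^ (s - 1) + y ^ (s - 1))) * d := by gcongr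
    _ = s * 2 ^ (s - 1) * (d ^ s + d * y ^ (s - 1)) := by rw [h2]; ring

lemma abs_freqNorm_sub_le {p q r : Fin 2 → ℤ} (h : p + q + r = 0) :
    |freqNorm r - freqNorm q| ≤ freqNorm p := by
  have hr : r = -(p + q) := (neg_eq_of_add_eq_zero_right h).symm
  have hq : q = -(p + r) := by rw [hr]; abel
  have h1 := freqNorm_add_le p q
  have h2 := freqNorm_add_le p r
  rw [← freqNorm_neg, ← hr] at h1
  rw [← freqNorm_neg, ← hq] at h2
  rw [abs_le]; constructor <;> linarith

end Commutator

/-- The `ℓ¹` norm of the gradient is controlled by the Sobolev norm. -/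
lemma exists_l1_le_sobolev {s : ℝ} (hs : 2 < s) : ∃ K : ℝ, 0 < K ∧
    ∀ (B : Finset (Fin 2 → ℤ)) (a : (Fin 2 → ℤ) → ℝ),
      ∑ k ∈ B, (1 + freqNorm k) * a k ≤
        K * Real.sqrt (∑ k ∈ B, (1 + freqNorm k ^ (2 * s)) * a k ^ 2) := by
  have hsum : Summable fun k : Fin 2 → ℤ => (1 + freqNorm k) ^ 2 / (1 + freqNorm k ^ (2 * s)) := by
    -- Away from k = 0 the quotient is at most 4|k|^{2-2s}, summable on ℤ² because 2s - 2 > 2. The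
    -- zero mode is added separately.
    have h1 : Summable fun k : Fin 2 → ℤ => 4 * ‖k‖ ^ (-(2 * s - 2)) :=
      (EisensteinSeries.summable_one_div_norm_rpow (by linarith)).mul_left 4
    have h2 : Summable fun k : Fin 2 → ℤ => if k = 0 then (1 : ℝ) else 0 :=
      summable_of_ne_finset_zero (s := {0}) (by intro b hb; simpa using hb)
    refine (h1.add h2).of_nonneg_of_le (fun k => ?_) (fun k => ?_)
    · have := Real.rpow_nonneg (freqNorm_nonneg k) (2 * s)
      positivity
    · by_cases hk : k = 0
      · subst hk
        have : freqNorm 0 = 0 := by simp [freqNorm]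
        rw [this, Real.zero_rpow (by linarith)]
        simp only [if_true]
        have := Real.rpow_nonneg (norm_nonneg (0 : Fin 2 → ℤ)) (-(2 * s - 2))
        linarith
      · rw [if_neg hk, add_zero]
        have hf := one_le_freqNorm hk
        have hn : 0 < ‖k‖ := norm_pos_iff.mpr hk
        have hpos : 0 < freqNorm k ^ (2 * s) := Real.rpow_pos_of_pos (by linarith) _
        have e1 : freqNorm k ^ (-(2 * s - 2)) ≤ ‖k‖ ^ (-(2 * s - 2)) :=
          Real.rpow_le_rpow_of_nonpos hn (norm_le_freqNorm k) (by linarith)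
        have e2 : freqNorm k ^ (-(2 * s - 2)) = freqNorm k ^ 2 / freqNorm k ^ (2 * s) := by
          rw [show -(2 * s - 2) = 2 - 2 * s by ring, Real.rpow_sub (by linarith)]
          norm_num
        calc (1 + freqNorm k) ^ 2 / (1 + freqNorm k ^ (2 * s))
            ≤ (2 * freqNorm k) ^ 2 / freqNorm k ^ (2 * s) := by
              gcongr <;> linarith
          _ = 4 * freqNorm k ^ (-(2 * s - 2)) := by rw [e2]; ring
          _ ≤ 4 * ‖k‖ ^ (-(2 * s - 2)) := by gcongr
  set S := ∑' k : Fin 2 → ℤ, (1 + freqNorm k) ^ 2 / (1 + freqNorm k ^ (2 * s)) with hS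
  have hw : ∀ k : Fin 2 → ℤ, 0 < 1 + freqNorm k ^ (2 * s) := fun k => by
    have := Real.rpow_nonneg (freqNorm_nonneg k) (2 * s)
    linarith
  -- The added 1 makes positivity of the constant immediate.
  refine ⟨Real.sqrt S + 1, by positivity, fun B a => ?_⟩
  have h := Real.sum_mul_le_sqrt_mul_sqrt B
    (fun k => (1 + freqNorm k) / Real.sqrt (1 + freqNorm k ^ (2 * s)))
    (fun k => Real.sqrt (1 + freqNorm k ^ (2 * s)) * a k)
  have e1 : ∀ k, (1 + freqNorm k) / Real.sqrt (1 + freqNorm k ^ (2 * s)) *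
      (Real.sqrt (1 + freqNorm k ^ (2 * s)) * a k) = (1 + freqNorm k) * a k := fun k => by
    have := (Real.sqrt_pos.mpr (hw k)).ne'
    field_simp
  simp only [e1, div_pow, mul_pow, Real.sq_sqrt (hw _).le] at h
  refine h.trans (mul_le_mul_of_nonneg_right ?_ (Real.sqrt_nonneg _))
  have : ∑ k ∈ B, (1 + freqNorm k) ^ 2 / (1 + freqNorm k ^ (2 * s)) ≤ S :=
    hsum.sum_le_tsum B fun k _ => div_nonneg (by positivity) (hw k).le
  linarith [Real.sqrt_le_sqrt this]

/-! ### The scheme in modes and its energy estimates. -/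

/-- The squared norm of the modes `u` on `B` with weight `m`. -/
noncomputable def weightedEnergy (B : Finset (Fin 2 → ℤ)) (m : (Fin 2 → ℤ) → ℝ)
    (u : (Fin 2 → ℤ) → Fin 2 → ℂ) : ℝ := ∑ k ∈ B, m k * amplitude (u k) ^ 2

/-- One step of the scheme, written for the conjugates of the Fourier coefficients of the real
fields; `P` collects the pressure modes. -/
structure IsModeStep (B : Finset (Fin 2 → ℤ)) (τ ν : ℝ) (u v : (Fin 2 → ℤ) → Fin 2 → ℂ) :
    Prop where
  div_left : ∀ k, freqDot (u k) k = 0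
  div_right : ∀ k, freqDot (v k) k = 0
  step : ∃ P : (Fin 2 → ℤ) → ℂ, ∀ r ∈ B, ∀ i,
    ((starRingEnd ℂ) (v r i) - (starRingEnd ℂ) (u r i)) / τ +
      Complex.I * (∑ p ∈ B, ∑ q ∈ B, if p + q + r = 0 then freqDot (u p) q * v q i else 0) +
      r i * P r = -(ν * ((freqNorm r ^ 2 : ℝ) : ℂ) * (starRingEnd ℂ) (v r i))

section Energy

variable {B : Finset (Fin 2 → ℤ)} {m : (Fin 2 → ℤ) → ℝ}

lemma weightedEnergy_nonneg (hm : ∀ k, 0 ≤ m k) (u : (Fin 2 → ℤ) → Fin 2 → ℂ) :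
    0 ≤ weightedEnergy B m u :=
  Finset.sum_nonneg fun k _ => mul_nonneg (hm k) (sq_nonneg _)

lemma weightedEnergy_mono {m' : (Fin 2 → ℤ) → ℝ} (h : ∀ k, m k ≤ m' k)
    (u : (Fin 2 → ℤ) → Fin 2 → ℂ) : weightedEnergy B m u ≤ weightedEnergy B m' u :=
  Finset.sum_le_sum fun k _ => mul_le_mul_of_nonneg_right (h k) (sq_nonneg _)

variable {τ ν : ℝ} {u v : (Fin 2 → ℤ) → Fin 2 → ℂ}

/-- The step tested against divergence free modes `z` with weight `m`. -/
lemma IsModeStep.tested (h : IsModeStep B τ ν u v) (m : (Fin 2 → ℤ) → ℝ)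
    {z : (Fin 2 → ℤ) → Fin 2 → ℂ} (hz : ∀ k, freqDot (z k) k = 0) :
    ∑ r ∈ B, (m r : ℂ) * ((bilinDot (fun i => (starRingEnd ℂ) (v r i - u r i)) (z r)) / τ +
        ν * ((freqNorm r ^ 2 : ℝ) : ℂ) * bilinDot (fun i => (starRingEnd ℂ) (v r i)) (z r)) =
      -Complex.I * triadSum B (fun p q r => (m r : ℂ) *
        (freqDot (u p) q * bilinDot (v q) (z r))) := by
  obtain ⟨P, hP⟩ := h.step
  have e : triadSum B (fun p q r => (m r : ℂ) * (freqDot (u p) q * bilinDot (v q) (z r))) =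
      ∑ r ∈ B, (m r : ℂ) * ∑ i, z r i *
        ∑ p ∈ B, ∑ q ∈ B, if p + q + r = 0 then freqDot (u p) q * v q i else 0 := by
    unfold triadSum
    refine (Finset.sum_congr rfl fun p _ => Finset.sum_comm).trans ?_
    rw [Finset.sum_comm]
    refine Finset.sum_congr rfl fun r _ => ?_
    simp only [Finset.mul_sum]
    conv_rhs => rw [Finset.sum_comm]
    refine Finset.sum_congr rfl fun p _ => ?_
    conv_rhs => rw [Finset.sum_comm]
    refine Finset.sum_congr rfl fun q _ => ?_
    split_ifs
    · simp only [bilinDot, Finset.mul_sum]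
      exact Finset.sum_congr rfl fun i _ => by ring
    · simp
  rw [e, Finset.mul_sum]
  refine Finset.sum_congr rfl fun r hr => ?_
  have h0 := hP r hr 0
  have h1 := hP r hr 1
  have hd := hz r
  simp only [freqDot, Fin.sum_univ_two] at hd
  simp only [bilinDot, Fin.sum_univ_two, map_sub]
  -- The pressure contributes P r times z r · r, which vanishes.
  linear_combination (m r : ℂ) * (z r 0 * h0 + z r 1 * h1 - P r * hd)

lemma re_bilinDot_conj_self (a : Fin 2 → ℂ) :
    (bilinDot (fun i => (starRingEnd ℂ) (a i)) a).re = amplitude a ^ 2 := by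
  simp only [amplitude_sq, bilinDot, Fin.sum_univ_two, Complex.add_re, Complex.mul_re,
    Complex.conj_re, Complex.conj_im, ← Complex.normSq_eq_norm_sq, Complex.normSq_apply]
  ring

/-- The polarization identity behind implicit Euler: it is the source of the increment term on the
left of the energy inequality. -/
lemma re_bilinDot_conj_sub (a b : Fin 2 → ℂ) :
    (bilinDot (fun i => (starRingEnd ℂ) (a i - b i)) a).re =
      (amplitude a ^ 2 + amplitude (a - b) ^ 2 - amplitude b ^ 2) / 2 := by
  simp only [amplitude_sq, bilinDot, Fin.sum_univ_two, Complex.add_re, Complex.mul_re,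
    Complex.conj_re, Complex.conj_im, ← Complex.normSq_eq_norm_sq, Complex.normSq_apply,
    Pi.sub_apply, Complex.sub_re, Complex.sub_im]
  ring

lemma amplitude_conj (a : Fin 2 → ℂ) : amplitude (fun i => (starRingEnd ℂ) (a i)) = amplitude a := by
  simp [amplitude]

lemma freqDot_sub (a b : Fin 2 → ℂ) (k : Fin 2 → ℤ) :
    freqDot (a - b) k = freqDot a k - freqDot b k := by
  simp [freqDot, Fin.sum_univ_two]; ring

/-- Real part of the step tested with v. The weight is left free because it serves three times: m =
1, the Sobolev weight and |k|². -/
lemma IsModeStep.energy_le (h : IsModeStep B τ ν u v) (hτ : 0 < τ) (m : (Fin 2 → ℤ) → ℝ) :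
    weightedEnergy B m v + weightedEnergy B m (v - u) +
        2 * τ * (ν * weightedEnergy B (fun k => m k * freqNorm k ^ 2) v) ≤
      weightedEnergy B m u + 2 * τ * ‖triadSum B (fun p q r => (m r : ℂ) *
        (freqDot (u p) q * bilinDot (v q) (v r)))‖ := by
  have e := congrArg Complex.re (h.tested m h.div_right)
  set S := triadSum B (fun p q r => (m r : ℂ) * (freqDot (u p) q * bilinDot (v q) (v r)))
  have h1 : (-Complex.I * S).re ≤ ‖S‖ := by
    refine (Complex.re_le_norm _).trans ?_
    simp
  rw [← e, Complex.re_sum] at h1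
  have h2 : ∑ r ∈ B, ((m r : ℂ) * ((bilinDot (fun i => (starRingEnd ℂ) (v r i - u r i)) (v r)) / τ +
        ν * ((freqNorm r ^ 2 : ℝ) : ℂ) * bilinDot (fun i => (starRingEnd ℂ) (v r i)) (v r))).re =
      (weightedEnergy B m v + weightedEnergy B m (v - u) - weightedEnergy B m u) / (2 * τ) +
        ν * weightedEnergy B (fun k => m k * freqNorm k ^ 2) v := by
    simp only [weightedEnergy]
    rw [← Finset.sum_add_distrib, ← Finset.sum_sub_distrib, Finset.sum_div, Finset.mul_sum,
      ← Finset.sum_add_distrib]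
    refine Finset.sum_congr rfl fun r _ => ?_
    rw [Complex.re_ofReal_mul, Complex.add_re, Complex.div_ofReal_re, re_bilinDot_conj_sub,
      ← Complex.ofReal_mul, Complex.re_ofReal_mul, re_bilinDot_conj_self, Pi.sub_apply]
    field_simp
  rw [h2] at h1
  have h3 := mul_le_mul_of_nonneg_left h1 (by linarith : (0 : ℝ) ≤ 2 * τ)
  rw [mul_add, mul_div_cancel₀ _ (by linarith : (2 : ℝ) * τ ≠ 0)] at h3
  linarith

lemma IsModeStep.l2_le (h : IsModeStep B τ ν u v) (hτ : 0 < τ) (hν : 0 < ν) :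
    weightedEnergy B (fun _ => 1) v ≤ weightedEnergy B (fun _ => 1) u := by
  have h1 := h.energy_le hτ (fun _ => 1)
  have h2 := triadSum_transport_eq_zero B h.div_left v (fun _ => 1)
  simp only [one_mul] at h2
  simp only [Complex.ofReal_one, one_mul] at h1
  rw [h2, norm_zero, mul_zero, add_zero] at h1
  have h3 : 0 ≤ weightedEnergy B (fun _ => 1) (v - u) :=
    weightedEnergy_nonneg (fun _ => zero_le_one) _
  have h4 : 0 ≤ weightedEnergy B (fun k => freqNorm k ^ 2) v :=
    weightedEnergy_nonneg (fun _ => sq_nonneg _) _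
  have h5 : 0 ≤ 2 * τ * (ν * weightedEnergy B (fun k => freqNorm k ^ 2) v) := by positivity
  linarith

lemma sqrt_sum_sq_eq (a : (Fin 2 → ℤ) → ℝ) (u : (Fin 2 → ℤ) → Fin 2 → ℂ) :
    Real.sqrt (∑ k ∈ B, (a k * amplitude (u k)) ^ 2) =
      Real.sqrt (weightedEnergy B (fun k => a k ^ 2) u) := by
  simp only [mul_pow, weightedEnergy]

/-- The squared Sobolev weight `1 + |k|^{2s}`. -/
noncomputable def sobolevWeight (s : ℝ) (k : Fin 2 → ℤ) : ℝ := 1 + freqNorm k ^ (2 * s)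

lemma sobolevWeight_nonneg (s : ℝ) (k : Fin 2 → ℤ) : 0 ≤ sobolevWeight s k := by
  have := Real.rpow_nonneg (freqNorm_nonneg k) (2 * s)
  unfold sobolevWeight; linarith

lemma freqNorm_rpow_sq (s : ℝ) (k : Fin 2 → ℤ) : (freqNorm k ^ s) ^ 2 = freqNorm k ^ (2 * s) := by
  rw [mul_comm, Real.rpow_mul (freqNorm_nonneg k)]; norm_num

lemma sqrt_rpow_energy_le (s : ℝ) (u : (Fin 2 → ℤ) → Fin 2 → ℂ) :
    Real.sqrt (∑ k ∈ B, (freqNorm k ^ s * amplitude (u k)) ^ 2) ≤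
      Real.sqrt (weightedEnergy B (sobolevWeight s) u) := by
  rw [sqrt_sum_sq_eq]
  refine Real.sqrt_le_sqrt (weightedEnergy_mono (fun k => ?_) u)
  rw [freqNorm_rpow_sq, sobolevWeight]; linarith

/-- The Kato–Ponce type commutator estimate behind the Sobolev bound. -/
lemma norm_triadSum_sobolev_le {s K : ℝ} (hs : 2 < s) (hK : 0 < K)
    (hKB : ∀ (a : (Fin 2 → ℤ) → ℝ), ∑ k ∈ B, (1 + freqNorm k) * a k ≤
        K * Real.sqrt (∑ k ∈ B, (1 + freqNorm k ^ (2 * s)) * a k ^ 2))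
    (hu : ∀ k, freqDot (u k) k = 0) (v : (Fin 2 → ℤ) → Fin 2 → ℂ) :
    ‖triadSum B (fun p q r => (sobolevWeight s r : ℂ) *
        (freqDot (u p) q * bilinDot (v q) (v r)))‖ ≤
      2 * (s * 2 ^ (s - 1)) * K * Real.sqrt (weightedEnergy B (sobolevWeight s) u) *
        weightedEnergy B (sobolevWeight s) v := by
  set L := s * 2 ^ (s - 1) with hL
  have hL0 : 0 ≤ L := by positivity
  set X := fun p q r => freqDot (u p) q * bilinDot (v q) (v r) with hX
  have hnn : ∀ k, 0 ≤ freqNorm k := freqNorm_nonneg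
  have hrp : ∀ (t : ℝ) k, 0 ≤ freqNorm k ^ t := fun t k => Real.rpow_nonneg (hnn k) t
  -- Skewness with weights 1 and |k|^s allows subtracting 1 + |q|^s|r|^s from the symbol 1 +
  -- |r|^{2s}, leaving the commutator |r|^s(|r|^s - |q|^s).
  have e : triadSum B (fun p q r => (sobolevWeight s r : ℂ) * X p q r) =
      triadSum B (fun p q r =>
        ((freqNorm r ^ s * (freqNorm r ^ s - freqNorm q ^ s) : ℝ) : ℂ) * X p q r) := by
    have h1 := triadSum_transport_eq_zero B hu v (fun _ => 1)
    have h2 := triadSum_transport_eq_zero B hu v (fun k => ((freqNorm k ^ s : ℝ) : ℂ))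
    rw [← sub_zero (triadSum B fun p q r => (sobolevWeight s r : ℂ) * X p q r), ← h1,
      ← triadSum_sub, ← sub_zero (triadSum B _), ← h2, ← triadSum_sub]
    refine triadSum_congr B fun p q r _ => ?_
    simp only [sobolevWeight, ← freqNorm_rpow_sq, hX]
    push_cast; ring
  have e2 : ∀ p q r : Fin 2 → ℤ, p + q + r = 0 →
      ‖((freqNorm r ^ s * (freqNorm r ^ s - freqNorm q ^ s) : ℝ) : ℂ) * X p q r‖ ≤
      L * ((freqNorm q * amplitude (v q)) * (freqNorm p ^ s * amplitude (u p)) *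
          (freqNorm r ^ s * amplitude (v r))) +
        L * ((freqNorm p * amplitude (u p)) * (freqNorm q ^ s * amplitude (v q)) *
          (freqNorm r ^ s * amplitude (v r))) := by
    intro p q r h
    have hc := abs_rpow_sub_rpow_le_of_abs_sub_le (by linarith : 1 < s) (hnn r) (hnn q) (hnn p)
      (abs_freqNorm_sub_le h)
    -- The factor |q| from the gradient of v completes |q|^{s-1} to |q|^s, so no mode carries more
    -- than s derivatives.
    have hq : freqNorm q ^ s = freqNorm q ^ (s - 1) * freqNorm q := by
      rw [← Real.rpow_add_one' (hnn q) (by linarith)]; ring_nf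
    have au := amplitude_nonneg (u p)
    have av := amplitude_nonneg (v q)
    have aw := amplitude_nonneg (v r)
    rw [norm_mul, Complex.norm_real, norm_mul, Real.norm_eq_abs, Real.norm_eq_abs,
      abs_of_nonneg (hrp s r), hX, norm_mul]
    calc freqNorm r ^ s * |freqNorm r ^ s - freqNorm q ^ s| *
          (‖freqDot (u p) q‖ * ‖bilinDot (v q) (v r)‖)
        ≤ freqNorm r ^ s * (L * (freqNorm p ^ s + freqNorm p * freqNorm q ^ (s - 1))) *
          ((amplitude (u p) * freqNorm q) * (amplitude (v q) * amplitude (v r))) := by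
          have := norm_freqDot_le (u p) q
          have := norm_bilinDot_le (v q) (v r)
          have := hrp s r
          have := hrp s p
          have := hrp (s - 1) q
          have := hnn p
          have := hnn q
          gcongr
      _ = _ := by rw [hq]; ring
  rw [e]
  refine (norm_triadSum_le B e2).trans ?_
  -- In the first term the ℓ¹ factor is the gradient of v at q; exchanging p and q puts it in the
  -- slot Young's inequality expects.
  rw [triadSum_add, triadSum_mul_left, triadSum_mul_left,
    triadSum_swap_left B fun p q r => (freqNorm q * amplitude (v q)) *
      (freqNorm p ^ s * amplitude (u p)) * (freqNorm r ^ s * amplitude (v r))]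
  set A := Real.sqrt (weightedEnergy B (sobolevWeight s) u)
  set D := Real.sqrt (weightedEnergy B (sobolevWeight s) v) with hD
  have hA0 : 0 ≤ A := Real.sqrt_nonneg _
  have hD0 : 0 ≤ D := Real.sqrt_nonneg _
  have hD2 : D ^ 2 = weightedEnergy B (sobolevWeight s) v :=
    Real.sq_sqrt (weightedEnergy_nonneg (sobolevWeight_nonneg s) v)
  have l1 : ∀ z : (Fin 2 → ℤ) → Fin 2 → ℂ, ∑ k ∈ B, freqNorm k * amplitude (z k) ≤
      K * Real.sqrt (weightedEnergy B (sobolevWeight s) z) := fun z => by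
    refine le_trans (Finset.sum_le_sum fun k _ => ?_) (hKB fun k => amplitude (z k))
    have := amplitude_nonneg (z k)
    nlinarith
  have hpos : ∀ (z : (Fin 2 → ℤ) → Fin 2 → ℂ) k, 0 ≤ freqNorm k * amplitude (z k) :=
    fun z k => mul_nonneg (hnn k) (amplitude_nonneg _)
  have t1 := triadSum_mul_le B (a := fun k => freqNorm k * amplitude (v k))
    (b := fun k => freqNorm k ^ s * amplitude (u k))
    (c := fun k => freqNorm k ^ s * amplitude (v k)) (hpos v)
  have t2 := triadSum_mul_le B (a := fun k => freqNorm k * amplitude (u k))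
    (b := fun k => freqNorm k ^ s * amplitude (v k))
    (c := fun k => freqNorm k ^ s * amplitude (v k)) (hpos u)
  have nu := sqrt_rpow_energy_le (B := B) s u
  have nv := sqrt_rpow_energy_le (B := B) s v
  have t1' := t1.trans (mul_le_mul (l1 v) (mul_le_mul nu nv (Real.sqrt_nonneg _) hA0)
    (by positivity) (by positivity))
  have t2' := t2.trans (mul_le_mul (l1 u) (mul_le_mul nv nv (Real.sqrt_nonneg _) hD0)
    (by positivity) (by positivity))
  have := mul_le_mul_of_nonneg_left t1' hL0
  have := mul_le_mul_of_nonneg_left t2' hL0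
  rw [← hD2]
  linarith

/-- The commutator bound is linear in the norm of u and quadratic in that of v, so it moves to the
left as a factor. Increment and dissipation are dropped, which keeps the estimate independent of ν.
-/
lemma IsModeStep.sobolev_le {s K : ℝ} (h : IsModeStep B τ ν u v) (hτ : 0 < τ) (hν : 0 < ν)
    (hs : 2 < s) (hK : 0 < K)
    (hKB : ∀ (a : (Fin 2 → ℤ) → ℝ), ∑ k ∈ B, (1 + freqNorm k) * a k ≤
        K * Real.sqrt (∑ k ∈ B, (1 + freqNorm k ^ (2 * s)) * a k ^ 2)) :
    weightedEnergy B (sobolevWeight s) v * (1 - 4 * (s * 2 ^ (s - 1)) * K * τ *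
        Real.sqrt (weightedEnergy B (sobolevWeight s) u)) ≤
      weightedEnergy B (sobolevWeight s) u := by
  have h1 := h.energy_le hτ (sobolevWeight s)
  have h2 := norm_triadSum_sobolev_le hs hK hKB h.div_left v
  have h3 : 0 ≤ weightedEnergy B (sobolevWeight s) (v - u) :=
    weightedEnergy_nonneg (sobolevWeight_nonneg s) _
  have h4 : 0 ≤ weightedEnergy B (fun k => sobolevWeight s k * freqNorm k ^ 2) v :=
    weightedEnergy_nonneg (fun k => mul_nonneg (sobolevWeight_nonneg s k) (sq_nonneg _)) _
  have h5 : 0 ≤ 2 * τ * (ν * weightedEnergy B (fun k => sobolevWeight s k * freqNorm k ^ 2) v) := by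
    positivity
  have h6 := mul_le_mul_of_nonneg_left h2 (by linarith : (0 : ℝ) ≤ 2 * τ)
  linarith

/-- Nonzero integer frequencies have length at least 1; this lets the Laplacian control the
gradient. -/
lemma freqNorm_le_sq (k : Fin 2 → ℤ) : freqNorm k ≤ freqNorm k ^ 2 := by
  by_cases hk : k = 0
  · subst hk; simp [freqNorm]
  · have := one_le_freqNorm hk
    nlinarith

lemma sqrt_energy_le_sqrt_laplace (v : (Fin 2 → ℤ) → Fin 2 → ℂ) :
    Real.sqrt (∑ k ∈ B, (freqNorm k * amplitude (v k)) ^ 2) ≤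
      Real.sqrt (∑ k ∈ B, (freqNorm k ^ 2 * amplitude (v k)) ^ 2) := by
  refine Real.sqrt_le_sqrt (Finset.sum_le_sum fun k _ => ?_)
  have := amplitude_nonneg (v k)
  have := freqNorm_nonneg k
  have := freqNorm_le_sq k
  gcongr

/-- The increment in `L²` is of order `τ`. -/
lemma IsModeStep.increment_le {s K : ℝ} (h : IsModeStep B τ ν u v) (hτ : 0 < τ) (hν : 0 < ν)
    (hKB : ∀ (a : (Fin 2 → ℤ) → ℝ), ∑ k ∈ B, (1 + freqNorm k) * a k ≤
        K * Real.sqrt (∑ k ∈ B, (1 + freqNorm k ^ (2 * s)) * a k ^ 2)) :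
    Real.sqrt (∑ k ∈ B, amplitude ((v - u) k) ^ 2) ≤
      τ * (K * Real.sqrt (weightedEnergy B (sobolevWeight s) u) + ν) *
        Real.sqrt (∑ k ∈ B, (freqNorm k ^ 2 * amplitude (v k)) ^ 2) := by
  set w := v - u with hw
  have hdw : ∀ k, freqDot (w k) k = 0 := fun k => by
    rw [hw, Pi.sub_apply, freqDot_sub, h.div_left, h.div_right, sub_zero]
  -- With the increment as test field, the time difference gives W²/τ, while convection and
  -- viscosity are each linear in W, so one factor W cancels.
  have e := congrArg Complex.re (h.tested (fun _ => 1) hdw)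
  simp only [Complex.ofReal_one, one_mul] at e
  set S := triadSum B (fun p q r => freqDot (u p) q * bilinDot (v q) (w r))
  set W := Real.sqrt (∑ k ∈ B, amplitude (w k) ^ 2) with hW
  set D := Real.sqrt (∑ k ∈ B, (freqNorm k ^ 2 * amplitude (v k)) ^ 2) with hD
  set A := Real.sqrt (weightedEnergy B (sobolevWeight s) u)
  have hW0 : 0 ≤ W := Real.sqrt_nonneg _
  have hD0 : 0 ≤ D := Real.sqrt_nonneg _
  have hA0 : 0 ≤ A := Real.sqrt_nonneg _
  have hW2 : W ^ 2 = ∑ k ∈ B, amplitude (w k) ^ 2 :=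
    Real.sq_sqrt (Finset.sum_nonneg fun _ _ => sq_nonneg _)
  have h1 : (-Complex.I * S).re ≤ ‖S‖ := by
    refine (Complex.re_le_norm _).trans ?_
    simp
  have hS : ‖S‖ ≤ K * A * (D * W) := by
    have b1 : ‖S‖ ≤ triadSum B (fun p q r =>
        amplitude (u p) * (freqNorm q * amplitude (v q)) * amplitude (w r)) := by
      refine norm_triadSum_le B fun p q r _ => ?_
      rw [norm_mul]
      have := norm_freqDot_le (u p) q
      have := norm_bilinDot_le (v q) (w r)
      have := amplitude_nonneg (u p)
      have := freqNorm_nonneg q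
      calc _ ≤ (amplitude (u p) * freqNorm q) * (amplitude (v q) * amplitude (w r)) := by gcongr
        _ = _ := by ring
    have b2 := triadSum_mul_le B (a := fun k => amplitude (u k))
      (b := fun k => freqNorm k * amplitude (v k)) (c := fun k => amplitude (w k))
      (fun k => amplitude_nonneg _)
    have b3 : ∑ k ∈ B, amplitude (u k) ≤ K * A := by
      refine le_trans (Finset.sum_le_sum fun k _ => ?_) (hKB fun k => amplitude (u k))
      have := amplitude_nonneg (u k)
      have := freqNorm_nonneg k
      nlinarith
    have b4 : 0 ≤ ∑ k ∈ B, amplitude (u k) := Finset.sum_nonneg fun k _ => amplitude_nonneg _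
    exact b1.trans (b2.trans (mul_le_mul b3
      (mul_le_mul_of_nonneg_right (sqrt_energy_le_sqrt_laplace v) hW0)
      (by positivity) (b4.trans b3)))
  have hV : ∑ r ∈ B, ((bilinDot (fun i => (starRingEnd ℂ) (v r i - u r i)) (w r)) / τ +
        ν * ((freqNorm r ^ 2 : ℝ) : ℂ) * bilinDot (fun i => (starRingEnd ℂ) (v r i)) (w r)).re ≥
      W ^ 2 / τ - ν * (D * W) := by
    have c1 := Real.sum_mul_le_sqrt_mul_sqrt B (fun k => freqNorm k ^ 2 * amplitude (v k))
      (fun k => amplitude (w k))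
    rw [← hD, ← hW] at c1
    have c2 := mul_le_mul_of_nonneg_left c1 hν.le
    rw [Finset.mul_sum] at c2
    rw [hW2, Finset.sum_div]
    refine le_trans (sub_le_sub_left c2 _) ?_
    rw [← Finset.sum_sub_distrib]
    refine Finset.sum_le_sum fun r _ => ?_
    have d1 : (bilinDot (fun i => (starRingEnd ℂ) (v r i - u r i)) (w r)).re =
      amplitude (w r) ^ 2 := re_bilinDot_conj_self (w r)
    rw [Complex.add_re, Complex.div_ofReal_re, d1, ← Complex.ofReal_mul, Complex.re_ofReal_mul]
    have d2 := norm_bilinDot_le (fun i => (starRingEnd ℂ) (v r i)) (w r)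
    rw [amplitude_conj] at d2
    have d3 := (abs_le.mp ((Complex.abs_re_le_norm _).trans d2)).1
    have d4 := mul_le_mul_of_nonneg_left d3 (by positivity : 0 ≤ ν * freqNorm r ^ 2)
    linarith
  rw [Complex.re_sum] at e
  have key : W ^ 2 / τ ≤ (K * A + ν) * D * W := by linarith
  rw [div_le_iff₀ hτ] at key
  by_contra! hlt
  have hWp : 0 < W := by
    rcases hW0.eq_or_lt with h0 | h0
    · exfalso
      -- No sign of K is assumed here; the embedding inequality itself forces K * A ≥ 0.
      have hKA : 0 ≤ K * A := by
        have b4 : 0 ≤ ∑ k ∈ B, (1 + freqNorm k) * amplitude (u k) :=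
          Finset.sum_nonneg fun k _ => mul_nonneg (by linarith [freqNorm_nonneg k])
            (amplitude_nonneg _)
        exact b4.trans (hKB fun k => amplitude (u k))
      have : 0 ≤ τ * (K * A + ν) * D := by positivity
      linarith
    · exact h0
  have := mul_lt_mul_of_pos_right hlt hWp
  linarith

/-- Since b(v, v, Δv) = 0, only v - u transports in the trilinear term. The increment bound supplies
one factor ‖Δv‖ and the test field the other; the smallness hypothesis says exactly that the
dissipation absorbs the product. -/
lemma IsModeStep.enstrophy_le {s K : ℝ} (h : IsModeStep B τ ν u v) (hτ : 0 < τ) (hν : 0 < ν)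
    (hKB : ∀ (a : (Fin 2 → ℤ) → ℝ), ∑ k ∈ B, (1 + freqNorm k) * a k ≤
        K * Real.sqrt (∑ k ∈ B, (1 + freqNorm k ^ (2 * s)) * a k ^ 2))
    (hsmall : τ * (K * Real.sqrt (weightedEnergy B (sobolevWeight s) u) + ν) *
      (K * Real.sqrt (weightedEnergy B (sobolevWeight s) v)) ≤ ν) :
    weightedEnergy B (fun k => freqNorm k ^ 2) v +
        weightedEnergy B (fun k => freqNorm k ^ 2) (v - u) ≤
      weightedEnergy B (fun k => freqNorm k ^ 2) u := by
  have h1 := h.energy_le hτ (fun k => freqNorm k ^ 2)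
  have hI := h.increment_le hτ hν hKB
  set w := v - u with hw
  set S := triadSum B (fun p q r => ((freqNorm r ^ 2 : ℝ) : ℂ) *
    (freqDot (u p) q * bilinDot (v q) (v r)))
  have eS : S = -triadSum B (fun p q r => ((freqNorm r ^ 2 : ℝ) : ℂ) *
      (freqDot (w p) q * bilinDot (v q) (v r))) := by
    rw [← zero_sub, ← triadSum_enstrophy_eq_zero B h.div_right, ← triadSum_sub]
    refine triadSum_congr B fun p q r _ => ?_
    rw [hw, Pi.sub_apply, freqDot_sub]; ring
  set D := Real.sqrt (∑ k ∈ B, (freqNorm k ^ 2 * amplitude (v k)) ^ 2) with hD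
  have hD0 : 0 ≤ D := Real.sqrt_nonneg _
  have hD2 : D ^ 2 = weightedEnergy B (fun k => freqNorm k ^ 2 * freqNorm k ^ 2) v := by
    rw [hD, Real.sq_sqrt (Finset.sum_nonneg fun _ _ => sq_nonneg _), weightedEnergy]
    exact Finset.sum_congr rfl fun k _ => by ring
  set E := Real.sqrt (weightedEnergy B (sobolevWeight s) v)
  have hl : ∑ k ∈ B, freqNorm k * amplitude (v k) ≤ K * E := by
    refine le_trans (Finset.sum_le_sum fun k _ => ?_) (hKB fun k => amplitude (v k))
    have := amplitude_nonneg (v k)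
    nlinarith
  have hl0 : 0 ≤ ∑ k ∈ B, freqNorm k * amplitude (v k) :=
    Finset.sum_nonneg fun k _ => mul_nonneg (freqNorm_nonneg k) (amplitude_nonneg _)
  have hS : ‖S‖ ≤ K * E * (Real.sqrt (∑ k ∈ B, amplitude (w k) ^ 2) * D) := by
    rw [eS, norm_neg]
    have b1 : ‖triadSum B (fun p q r => ((freqNorm r ^ 2 : ℝ) : ℂ) *
        (freqDot (w p) q * bilinDot (v q) (v r)))‖ ≤ triadSum B (fun p q r =>
        amplitude (w p) * (freqNorm q * amplitude (v q)) * (freqNorm r ^ 2 * amplitude (v r))) := by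
      refine norm_triadSum_le B fun p q r _ => ?_
      rw [norm_mul, norm_mul, Complex.norm_real, Real.norm_eq_abs, abs_of_nonneg (sq_nonneg _)]
      have := norm_freqDot_le (w p) q
      have := norm_bilinDot_le (v q) (v r)
      have := amplitude_nonneg (w p)
      have := freqNorm_nonneg q
      calc _ ≤ freqNorm r ^ 2 *
            ((amplitude (w p) * freqNorm q) * (amplitude (v q) * amplitude (v r))) := by gcongr
        _ = _ := by ring
    have b2 := triadSum_mul_le B (a := fun k => freqNorm k * amplitude (v k))
      (b := fun k => amplitude (w k)) (c := fun k => freqNorm k ^ 2 * amplitude (v k))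
      (fun k => mul_nonneg (freqNorm_nonneg k) (amplitude_nonneg _))
    refine (b1.trans (le_of_eq ((triadSum_swap_left B _).trans ?_))).trans (b2.trans (mul_le_mul_of_nonneg_right hl (by positivity)))
    exact triadSum_congr B fun p q r _ => by ring
  have hfin : ‖S‖ ≤ ν * D ^ 2 := by
    calc ‖S‖ ≤ K * E * (Real.sqrt (∑ k ∈ B, amplitude (w k) ^ 2) * D) := hS
      _ ≤ K * E * (τ * (K * Real.sqrt (weightedEnergy B (sobolevWeight s) u) + ν) * D * D) := by
          have := hl0.trans hl
          gcongr
      _ = (τ * (K * Real.sqrt (weightedEnergy B (sobolevWeight s) u) + ν) * (K * E)) * D ^ 2 := by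
          ring
      _ ≤ ν * D ^ 2 := by gcongr
  rw [← hD2] at h1
  have := mul_le_mul_of_nonneg_left hfin (by linarith : (0 : ℝ) ≤ 2 * τ)
  linarith

end Energy

/-! ### Dictionary between function norms and weighted energies. -/

section Norms

variable {N : ℕ} {f : (Fin 2 → ℝ) → Fin 2 → ℝ} {c : (Fin 2 → ℤ) → Fin 2 → ℂ}

lemma norm_torusFourierCoeff_sq (g : (Fin 2 → ℝ) → ℝ) (k : Fin 2 → ℤ) :
    ‖torusFourierCoeff g k‖ ^ 2 = (2 * Real.pi) ^ 4 * ‖modeCoeff g k‖ ^ 2 := by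
  have h : torusFourierCoeff g k = (2 * (Real.pi : ℂ)) ^ 2 * modeCoeff g k := by
    rw [modeCoeff]; field_simp
  rw [h, norm_mul, mul_pow]
  congr 1
  rw [norm_pow, norm_mul, Complex.norm_real, Real.norm_eq_abs, abs_of_pos Real.pi_pos,
    Complex.norm_ofNat]
  ring

lemma weightedEnergy_eq_sum_sum (B : Finset (Fin 2 → ℤ)) (m : (Fin 2 → ℤ) → ℝ)
    (c : (Fin 2 → ℤ) → Fin 2 → ℂ) :
    weightedEnergy B m c = ∑ i, ∑ k ∈ B, m k * ‖c k i‖ ^ 2 := by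
  rw [weightedEnergy, Finset.sum_comm]
  exact Finset.sum_congr rfl fun k _ => by rw [amplitude_sq, Finset.mul_sum]

lemma gradL2Norm_sq (hf : ∀ i, HasModes N (component f i) (fun k => c k i)) :
    gradL2Norm f ^ 2 =
      (2 * Real.pi) ^ 2 * weightedEnergy (freqBox N) (fun k => freqNorm k ^ 2) c := by
  rw [gradL2Norm, Real.sq_sqrt]
  · rw [weightedEnergy_eq_sum_sum, Finset.mul_sum]
    refine Finset.sum_congr rfl fun i _ => ?_
    simp only [fun j => ((hf i).partialD j).integral_sq]
    rw [← Finset.mul_sum, Finset.sum_comm]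
    congr 1
    refine Finset.sum_congr rfl fun k _ => ?_
    rw [freqNorm_sq, Finset.sum_mul]
    refine Finset.sum_congr rfl fun j _ => ?_
    rw [norm_mul, norm_mul, Complex.norm_I, one_mul, mul_pow, Complex.norm_intCast, sq_abs]
  · exact Finset.sum_nonneg fun i _ => Finset.sum_nonneg fun j _ =>
      integral_nonneg fun x => sq_nonneg _

lemma hsNorm_eq (s : ℝ) (hf : ∀ i, HasModes N (component f i) (fun k => c k i)) :
    hsNorm s f = 2 * Real.pi * Real.sqrt (weightedEnergy (freqBox N) (sobolevWeight s) c) := by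
  have e : ∑ i, ∑' k : Fin 2 → ℤ,
      (1 + freqNorm k ^ (2 * s)) * ‖torusFourierCoeff (component f i) k‖ ^ 2 =
      ((2 * Real.pi) ^ 2) ^ 2 * weightedEnergy (freqBox N) (sobolevWeight s) c := by
    rw [weightedEnergy_eq_sum_sum, Finset.mul_sum]
    refine Finset.sum_congr rfl fun i _ => ?_
    rw [tsum_eq_sum (s := freqBox N), Finset.mul_sum]
    · refine Finset.sum_congr rfl fun k hk => ?_
      rw [norm_torusFourierCoeff_sq, (hf i).modeCoeff_eq, if_pos hk, sobolevWeight]; ring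
    · intro k hk
      rw [norm_torusFourierCoeff_sq, (hf i).modeCoeff_eq, if_neg hk]; simp
  rw [hsNorm, e, Real.sqrt_mul (by positivity), Real.sqrt_sq (by positivity)]
  field_simp

/-- A partial sum against the full series. The summability in `MemHs` is essential: a divergent
`tsum` would be 0. -/
lemma weightedEnergy_le_hsNorm_sq {s : ℝ} (B : Finset (Fin 2 → ℤ)) (hf : MemHs s f) :
    weightedEnergy B (sobolevWeight s) (fun k i => modeCoeff (component f i) k) ≤
      hsNorm s f ^ 2 := by
  have hW : ∀ k : Fin 2 → ℤ, 0 ≤ 1 + freqNorm k ^ (2 * s) := sobolevWeight_nonneg s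
  have hnn : 0 ≤ ∑ i, ∑' k : Fin 2 → ℤ,
      (1 + freqNorm k ^ (2 * s)) * ‖torusFourierCoeff (component f i) k‖ ^ 2 :=
    Finset.sum_nonneg fun i _ => tsum_nonneg fun k => mul_nonneg (hW k) (sq_nonneg _)
  have h1 : (2 * Real.pi) ^ 4 * weightedEnergy B (sobolevWeight s)
      (fun k i => modeCoeff (component f i) k) ≤ ∑ i, ∑' k : Fin 2 → ℤ,
      (1 + freqNorm k ^ (2 * s)) * ‖torusFourierCoeff (component f i) k‖ ^ 2 := by
    rw [weightedEnergy_eq_sum_sum, Finset.mul_sum]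
    refine Finset.sum_le_sum fun i _ => ?_
    refine le_trans (le_of_eq ?_) ((hf i).2.2.sum_le_tsum B fun k _ =>
      mul_nonneg (hW k) (sq_nonneg _))
    rw [Finset.mul_sum]
    refine Finset.sum_congr rfl fun k _ => ?_
    rw [norm_torusFourierCoeff_sq, sobolevWeight]; ring
  have h2 : 0 ≤ weightedEnergy B (sobolevWeight s) (fun k i => modeCoeff (component f i) k) :=
    weightedEnergy_nonneg (sobolevWeight_nonneg s) _
  -- The bound even holds with an extra factor (2π)² on the left, which is discarded.
  have hpi : (1 : ℝ) ≤ (2 * Real.pi) ^ 2 := by nlinarith [Real.pi_gt_three]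
  rw [hsNorm, mul_pow, Real.sq_sqrt hnn, div_pow, one_pow, one_div, ← div_eq_inv_mul,
    le_div_iff₀ (by positivity)]
  refine le_trans ?_ h1
  rw [mul_comm, show (2 * Real.pi) ^ 4 = (2 * Real.pi) ^ 2 * (2 * Real.pi) ^ 2 by ring]
  exact mul_le_mul_of_nonneg_right (le_mul_of_one_le_left (by positivity) hpi) h2

lemma sobolevWeight_one (k : Fin 2 → ℤ) : sobolevWeight 1 k = 1 + freqNorm k ^ 2 := by
  rw [sobolevWeight]; norm_num

lemma weightedEnergy_sobolevWeight_one (B : Finset (Fin 2 → ℤ)) (c : (Fin 2 → ℤ) → Fin 2 → ℂ) :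
    weightedEnergy B (sobolevWeight 1) c =
      weightedEnergy B (fun _ => 1) c + weightedEnergy B (fun k => freqNorm k ^ 2) c := by
  simp only [weightedEnergy, sobolevWeight_one, add_mul, Finset.sum_add_distrib]

end Norms

/-! ### The weak divergence condition in Fourier coefficients. -/

section Divergence

lemma hasFDerivAt_phase (k : Fin 2 → ℤ) (x : Fin 2 → ℝ) :
    HasFDerivAt (phase k)
      (∑ j, (k j : ℝ) • ContinuousLinearMap.proj (R := ℝ) (φ := fun _ : Fin 2 => ℝ) j) x := by
  unfold phase
  exact HasFDerivAt.fun_sum fun j _ => (hasFDerivAt_apply j x).const_mul _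

lemma partialD_cos_phase (k : Fin 2 → ℤ) (j : Fin 2) (x : Fin 2 → ℝ) :
    partialD j (fun x => Real.cos (phase k x)) x = -(k j * Real.sin (phase k x)) := by
  rw [partialD, ((hasFDerivAt_phase k x).cos).fderiv]
  fin_cases j <;> simp <;> ring

lemma partialD_sin_phase (k : Fin 2 → ℤ) (j : Fin 2) (x : Fin 2 → ℝ) :
    partialD j (fun x => Real.sin (phase k x)) x = k j * Real.cos (phase k x) := by
  rw [partialD, ((hasFDerivAt_phase k x).sin).fderiv]
  fin_cases j <;> simp <;> ring

lemma contDiff_phase (k : Fin 2 → ℤ) : ContDiff ℝ (⊤ : ℕ∞) (phase k) := by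
  unfold phase; fun_prop

lemma phase_periodic (k : Fin 2 → ℤ) (x : Fin 2 → ℝ) (m : Fin 2 → ℤ) :
    phase k (fun j => x j + 2 * Real.pi * (m j : ℝ)) =
      phase k x + ((∑ j, k j * m j : ℤ) : ℝ) * (2 * Real.pi) := by
  simp only [phase, Fin.sum_univ_two]; push_cast; ring

lemma isPeriodic_cos_phase (k : Fin 2 → ℤ) : IsPeriodic fun x => Real.cos (phase k x) := by
  intro x m
  simp only [phase_periodic, Real.cos_add_int_mul_two_pi]

lemma isPeriodic_sin_phase (k : Fin 2 → ℤ) : IsPeriodic fun x => Real.sin (phase k x) := by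
  intro x m
  simp only [phase_periodic, Real.sin_add_int_mul_two_pi]

lemma torusFourierCoeff_eq_cos_sub_sin {g : (Fin 2 → ℝ) → ℝ} (hg : IntegrableOn g torusCell)
    (k : Fin 2 → ℤ) : torusFourierCoeff g k =
      ((∫ x in torusCell, g x * Real.cos (phase k x) : ℝ) : ℂ) -
        Complex.I * ((∫ x in torusCell, g x * Real.sin (phase k x) : ℝ) : ℂ) := by
  have hc : IntegrableOn (fun x => g x * Real.cos (phase k x)) torusCell :=
    hg.mul_continuousOn (Real.continuous_cos.comp (continuous_phase k)).continuousOn isCompact_Icc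
  have hs : IntegrableOn (fun x => g x * Real.sin (phase k x)) torusCell :=
    hg.mul_continuousOn (Real.continuous_sin.comp (continuous_phase k)).continuousOn isCompact_Icc
  rw [← integral_complex_ofReal, ← integral_complex_ofReal, ← integral_const_mul,
    ← integral_sub hc.ofReal (hs.ofReal.const_mul _), torusFourierCoeff]
  refine integral_congr_ae (Filter.Eventually.of_forall fun x => ?_)
  simp only [exp_neg_phase, fourierMode_eq_cos_add_sin, phase_neg, Real.cos_neg, Real.sin_neg]
  push_cast; ring

/-- The test functions cos(k · x) and sin(k · x) give the two real components of k · û(k) = 0. -/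
lemma freqDot_modeCoeff_of_weakDivFree {s : ℝ} {f : (Fin 2 → ℝ) → Fin 2 → ℝ} (hf : MemHs s f)
    (hd : WeakDivFree f) (k : Fin 2 → ℤ) :
    freqDot (fun i => modeCoeff (component f i) k) k = 0 := by
  have hfin : IsFiniteMeasure (volume.restrict torusCell) :=
    ⟨by simpa [torusCell] using (isCompact_Icc (a := fun _ : Fin 2 => (0 : ℝ))
      (b := fun _ => 2 * Real.pi)).measure_lt_top⟩
  have hi : ∀ i, IntegrableOn (component f i) torusCell := fun i =>
    ((hf i).2.1).integrable (by norm_num)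
  have hc := hd _ (Real.contDiff_cos.comp (contDiff_phase k)) (isPeriodic_cos_phase k)
  have hs := hd _ (Real.contDiff_sin.comp (contDiff_phase k)) (isPeriodic_sin_phase k)
  have ec : ∀ j, ∫ x in torusCell, f x j * partialD j (Real.cos ∘ phase k) x =
      -(k j : ℝ) * ∫ x in torusCell, component f j x * Real.sin (phase k x) := fun j => by
    rw [← integral_const_mul]
    refine integral_congr_ae (Filter.Eventually.of_forall fun x => ?_)
    have := partialD_cos_phase k j x
    simp only [Function.comp_def, this, component]; ring
  have es : ∀ j, ∫ x in torusCell, f x j * partialD j (Real.sin ∘ phase k) x =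
      (k j : ℝ) * ∫ x in torusCell, component f j x * Real.cos (phase k x) := fun j => by
    rw [← integral_const_mul]
    refine integral_congr_ae (Filter.Eventually.of_forall fun x => ?_)
    have := partialD_sin_phase k j x
    simp only [Function.comp_def, this, component]; ring
  simp only [ec, es, Fin.sum_univ_two] at hc hs
  have hc' := congrArg (fun t : ℝ => (t : ℂ)) hc
  have hs' := congrArg (fun t : ℝ => (t : ℂ)) hs
  simp only [Complex.ofReal_add, Complex.ofReal_mul, Complex.ofReal_neg, Complex.ofReal_zero,
    Complex.ofReal_intCast] at hc' hs'
  simp only [freqDot, modeCoeff, torusFourierCoeff_eq_cos_sub_sin (hi _), Fin.sum_univ_two]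
  linear_combination 1 / (2 * (Real.pi : ℂ)) ^ 2 * (hs' + Complex.I * hc')

end Divergence

/-! ### From the scheme to the mode equations. -/

section Scheme

variable {N : ℕ} {τ ν : ℝ} {u₀ : (Fin 2 → ℝ) → Fin 2 → ℝ} {u : ℕ → (Fin 2 → ℝ) → Fin 2 → ℝ}

/-- The Fourier coefficients of a vector field. -/
noncomputable def fieldCoeff (f : (Fin 2 → ℝ) → Fin 2 → ℝ) (k : Fin 2 → ℤ) (i : Fin 2) : ℂ :=
  modeCoeff (component f i) k

lemma IsSemiImplicitScheme.hasModes (h : IsSemiImplicitScheme N τ ν u₀ u) (n : ℕ) (i : Fin 2) :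
    HasModes N (component (u n) i) (fun k => fieldCoeff (u n) k i) :=
  hasModes_of_mem_trigSpace (h.mem n i)

lemma IsSemiImplicitScheme.fieldCoeff_zero (h : IsSemiImplicitScheme N τ ν u₀ u)
    {k : Fin 2 → ℤ} (hk : k ∈ freqBox N) : fieldCoeff (u 0) k = fieldCoeff u₀ k := by
  ext i
  have h1 : component (u 0) i = fourierTrunc N (component u₀ i) := funext fun x => h.init x i
  rw [fieldCoeff, h1, (hasModes_fourierTrunc N _).modeCoeff_eq, if_pos hk, fieldCoeff]

/-- The scheme imposes the constraint only from the first step on. At n = 0 it is inherited from the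
initial datum, because truncation keeps or deletes whole modes. -/
lemma IsSemiImplicitScheme.freqDot_eq_zero {s : ℝ} (h : IsSemiImplicitScheme N τ ν u₀ u)
    (hu₀ : MemHs s u₀) (hd : WeakDivFree u₀) (n : ℕ) (k : Fin 2 → ℤ) :
    freqDot (fieldCoeff (u n) k) k = 0 := by
  by_cases hk : k ∈ freqBox N
  · cases n with
    | zero =>
      rw [h.fieldCoeff_zero hk]
      exact freqDot_modeCoeff_of_weakDivFree hu₀ hd k
    | succ n =>
      have h1 : HasModes N (divergence (u (n + 1)))
          (fun k => Complex.I * k 0 * fieldCoeff (u (n + 1)) k 0 +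
            Complex.I * k 1 * fieldCoeff (u (n + 1)) k 1) := by
        have := ((h.hasModes (n + 1) 0).partialD 0).add ((h.hasModes (n + 1) 1).partialD 1)
        intro x
        rw [← this x, divergence, Fin.sum_univ_two]
      have h2 : divergence (u (n + 1)) = fun _ => 0 := funext (h.div_free n)
      rw [h2] at h1
      have h3 := h1.unique (hasModes_zero N) hk
      rw [freqDot, Fin.sum_univ_two]
      linear_combination -Complex.I * h3 + (fieldCoeff (u (n + 1)) k 0 * k 0 +
        fieldCoeff (u (n + 1)) k 1 * k 1) * Complex.I_sq
  · have : fieldCoeff (u n) k = 0 := by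
      ext i
      rw [fieldCoeff, (h.hasModes n i).modeCoeff_eq, if_neg hk]; rfl
    rw [this]; simp [freqDot]

lemma IsSemiImplicitScheme.isModeStep {s : ℝ} (h : IsSemiImplicitScheme N τ ν u₀ u)
    (hu₀ : MemHs s u₀) (hd : WeakDivFree u₀) (n : ℕ) :
    IsModeStep (freqBox N) τ ν (fieldCoeff (u n)) (fieldCoeff (u (n + 1))) := by
  refine ⟨h.freqDot_eq_zero hu₀ hd n, h.freqDot_eq_zero hu₀ hd (n + 1), ?_⟩
  obtain ⟨p, hp, hstep⟩ := h.step n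
  -- At frequency -r the coefficient of ∂ᵢp is -i rᵢ times that of p, hence this choice of P.
  refine ⟨fun r => -Complex.I * modeCoeff p (-r), fun r hr i => ?_⟩
  have hl := (((((h.hasModes (n + 1) i).sub (h.hasModes n i)).const_mul τ⁻¹).add
    (hasModes_fourierTrunc N (convect (u n) (u (n + 1)) i))).add
      ((hasModes_of_mem_trigSpace hp).partialD i))
  have hrr := (h.hasModes (n + 1) i).laplace.const_mul ν
  have hfun : (fun x => τ⁻¹ * (component (u (n + 1)) i x - component (u n) i x) +
      fourierTrunc N (convect (u n) (u (n + 1)) i) x + partialD i p x) =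
      fun x => ν * laplace (component (u (n + 1)) i) x := by
    ext x
    rw [← hstep x i, component, component]; ring
  rw [hfun] at hl
  -- Coefficients are compared at -r: for real fields these are the conjugates at r, and p + q = -r
  -- becomes the symmetric triad condition.
  have e := hl.unique hrr (neg_mem_freqBox.mpr hr)
  have hconv : modeCoeff (convect (u n) (u (n + 1)) i) (-r) =
      Complex.I * ∑ p ∈ freqBox N, ∑ q ∈ freqBox N, if p + q + r = 0 then
        freqDot (fieldCoeff (u n) p) q * fieldCoeff (u (n + 1)) q i else 0 := by
    have h1 := modeCoeff_sum_mul (fun j => h.hasModes n j)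
      (fun j => (h.hasModes (n + 1) i).partialD j) (-r)
    refine Eq.trans h1 ?_
    rw [Finset.mul_sum]
    refine Finset.sum_congr rfl fun p _ => ?_
    rw [Finset.mul_sum]
    refine Finset.sum_congr rfl fun q _ => ?_
    simp only [eq_neg_iff_add_eq_zero, mul_ite, mul_zero]
    congr 1
    rw [freqDot, Finset.sum_mul, Finset.mul_sum]
    exact Finset.sum_congr rfl fun j _ => by ring
  have hneg : ∀ m, fieldCoeff (u m) (-r) i = (starRingEnd ℂ) (fieldCoeff (u m) r i) := fun m =>
    modeCoeff_neg_freq _ _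
  rw [hconv, hneg, hneg] at e
  rw [freqNorm_sq]
  simp only [Pi.neg_apply] at e
  push_cast at e ⊢
  simp only [neg_sq] at e
  rw [div_eq_inv_mul]
  linear_combination e

end Scheme

/-! ### The bootstrap and the conclusion. -/

/-- While √E ≤ 2Y, a step enlarges E by at most 1/(1 - a) with a = 2gY. By Bernoulli (1 - a)^n ≥ 1 -
na ≥ 3/4, so E ≤ (4/3)Y², well below 4Y², and the bootstrap closes. -/
lemma sqrt_le_two_mul_of_riccati {E : ℕ → ℝ} {g Y : ℝ} {M : ℕ} (hE : ∀ n, 0 ≤ E n) (hg : 0 ≤ g)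
    (hY : 0 ≤ Y) (h0 : E 0 ≤ Y ^ 2) (hstep : ∀ n, E (n + 1) * (1 - g * Real.sqrt (E n)) ≤ E n)
    (hM : M * (2 * g * Y) ≤ 1 / 4) {n : ℕ} (hn : n ≤ M) : Real.sqrt (E n) ≤ 2 * Y := by
  set a := 2 * g * Y with ha
  have ha0 : 0 ≤ a := by positivity
  have hsqrt : ∀ n ≤ M, E n * (1 - a) ^ n ≤ Y ^ 2 → Real.sqrt (E n) ≤ 2 * Y := by
    intro n hn hEn
    have hna : (n : ℝ) * a ≤ 1 / 4 :=
      (mul_le_mul_of_nonneg_right (by exact_mod_cast hn) ha0).trans hM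
    have hb : 3 / 4 ≤ (1 - a) ^ n := by
      rcases n.eq_zero_or_pos with rfl | hpos
      · norm_num
      · have : (1 : ℝ) ≤ n := by exact_mod_cast hpos
        have := one_add_mul_le_pow (a := -a) (by nlinarith) n
        rw [← sub_eq_add_neg 1 a] at this
        linarith
    have := mul_le_mul_of_nonneg_left hb (hE n)
    rw [Real.sqrt_le_iff]
    exact ⟨by positivity, by nlinarith⟩
  have main : ∀ n ≤ M, E n * (1 - a) ^ n ≤ Y ^ 2 := by
    intro n
    induction n with
    | zero => intro _; simpa using h0
    | succ n ih =>
      intro hn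
      have h1 := ih (by omega)
      have h2 := hsqrt n (by omega) h1
      have h3 : g * Real.sqrt (E n) ≤ a := by
        have := mul_le_mul_of_nonneg_left h2 hg
        linarith
      have hM1 : (1 : ℝ) ≤ M := by
        have : 1 ≤ M := by omega
        exact_mod_cast this
      have ha1 : 0 ≤ 1 - a := by nlinarith
      have h4 : E (n + 1) * (1 - a) ≤ E n :=
        (mul_le_mul_of_nonneg_left (by linarith) (hE _)).trans (hstep n)
      calc E (n + 1) * (1 - a) ^ (n + 1) = E (n + 1) * (1 - a) * (1 - a) ^ n := by ring
        _ ≤ E n * (1 - a) ^ n := by gcongr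
        _ ≤ Y ^ 2 := h1
  exact hsqrt n hn (main n hn)

theorem corollary1p2 (s : ℝ) (hs : 2 < s) :
    ∃ Cs : ℝ, 0 < Cs ∧ ∀ R : ℝ, 0 < R → ∃ c : ℝ, 0 < c ∧
      ∀ u₀ : (Fin 2 → ℝ) → Fin 2 → ℝ, MemHs s u₀ → WeakDivFree u₀ → hsNorm s u₀ ≤ R →
      ∀ T : ℝ, 0 < T → 4 * Cs * T * hsNorm s u₀ ≤ 1 →
      ∀ (N M : ℕ) (τ ν : ℝ), 2 ≤ N → 1 ≤ M → τ = T / M → 0 < ν → τ ≤ c * ν →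
      ∀ u : ℕ → (Fin 2 → ℝ) → Fin 2 → ℝ, IsSemiImplicitScheme N τ ν u₀ u →
      ∀ n : ℕ, n ≤ M →
        gradL2Norm (u (n + 1)) ^ 2 + gradL2Norm (u (n + 1) - u n) ^ 2 ≤ gradL2Norm (u n) ^ 2 ∧
        hsNorm 1 (u (n + 1)) ≤ hsNorm 1 (u n) := by
  obtain ⟨K, hK, hKB⟩ := exists_l1_le_sobolev hs
  set G := s * 2 ^ (s - 1) * K with hG
  have hG0 : 0 < G := by positivity
  -- This constant yields 64GTY ≤ 1 for the Riccati bootstrap and 16KTY ≤ 1 for the term τKYν in the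
  -- smallness condition. The choice of c gives 8K²Y²τ ≤ ν for the remaining term, using Y ≤ R.
  refine ⟨16 * G + 4 * K, by positivity, fun R hR => ⟨1 / (8 * K ^ 2 * R ^ 2), by positivity, ?_⟩⟩
  intro u₀ hu₀ hd hYR T hT hCT N M τ ν _ hM hτ hν hτν u hu n hn
  set Y := hsNorm s u₀ with hYdef
  have hY : 0 ≤ Y := by rw [hYdef, hsNorm]; positivity
  have hM0 : (1 : ℝ) ≤ M := by exact_mod_cast hM
  have hτ0 : 0 < τ := by rw [hτ]; positivity
  have hMτ : M * τ = T := by rw [hτ]; field_simp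
  have hτT : τ ≤ T := by nlinarith
  have hGT : 0 ≤ G * T * Y := by positivity
  have hKT : 0 ≤ K * T * Y := by positivity
  set E : ℕ → ℝ := fun n => weightedEnergy (freqBox N) (sobolevWeight s) (fieldCoeff (u n)) with hE
  have hstep := hu.isModeStep hu₀ hd
  have hE0 : E 0 ≤ Y ^ 2 := by
    refine le_trans (le_of_eq ?_) (weightedEnergy_le_hsNorm_sq (freqBox N) hu₀)
    exact Finset.sum_congr rfl fun k hk => by rw [hu.fieldCoeff_zero hk]; rfl
  -- The case n = M involves step M + 1, so the bootstrap runs over M + 1 steps. As (M + 1)τ ≤ 2T,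
  -- the requirement is 16GTY ≤ 1/4.
  have hbound : ∀ n ≤ M + 1, Real.sqrt (E n) ≤ 2 * Y := by
    intro n hn
    refine sqrt_le_two_mul_of_riccati (E := E) (g := 4 * G * τ) (M := M + 1)
      (fun n => weightedEnergy_nonneg (sobolevWeight_nonneg s) _) (by positivity) hY hE0
      (fun n => ?_) ?_ hn
    · refine le_trans (le_of_eq ?_) ((hstep n).sobolev_le hτ0 hν hs hK (hKB _))
      rw [hG]; ring
    · push_cast
      have h1 : τ * (G * Y) ≤ T * (G * Y) := by gcongr
      have h2 : M * τ * (G * Y) = T * (G * Y) := by rw [hMτ]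
      linarith
  have b1 := hbound n (by omega)
  have b2 := hbound (n + 1) (by omega)
  have hsmall : τ * (K * Real.sqrt (E n) + ν) * (K * Real.sqrt (E (n + 1))) ≤ ν := by
    have h1 : τ * (K * Y) ≤ T * (K * Y) := by gcongr
    have h2 : τ * (8 * K ^ 2 * Y ^ 2) ≤ ν := by
      calc τ * (8 * K ^ 2 * Y ^ 2) ≤ (1 / (8 * K ^ 2 * R ^ 2) * ν) * (8 * K ^ 2 * R ^ 2) := by
            gcongr
        _ = ν := by field_simp
    have h3 : τ * (K * Y) * ν ≤ 1 / 16 * ν :=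
      mul_le_mul_of_nonneg_right (by linarith) hν.le
    -- The two terms are at most ν/2 and ν/8.
    calc τ * (K * Real.sqrt (E n) + ν) * (K * Real.sqrt (E (n + 1)))
        ≤ τ * (K * (2 * Y) + ν) * (K * (2 * Y)) := by gcongr
      _ = τ * (8 * K ^ 2 * Y ^ 2) / 2 + 2 * (τ * (K * Y) * ν) := by ring
      _ ≤ ν := by linarith
  have hens := (hstep n).enstrophy_le hτ0 hν (hKB _) hsmall
  have hL2 := (hstep n).l2_le hτ0 hν
  have hdiff : ∀ i, HasModes N (component (u (n + 1) - u n) i)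
      (fun k => (fieldCoeff (u (n + 1)) - fieldCoeff (u n)) k i) := fun i =>
    (hu.hasModes (n + 1) i).sub (hu.hasModes n i)
  constructor
  · rw [gradL2Norm_sq (hu.hasModes (n + 1)), gradL2Norm_sq (hu.hasModes n), gradL2Norm_sq hdiff,
      ← mul_add]
    gcongr
  · rw [hsNorm_eq 1 (hu.hasModes (n + 1)), hsNorm_eq 1 (hu.hasModes n),
      weightedEnergy_sobolevWeight_one, weightedEnergy_sobolevWeight_one]
    have h0 : 0 ≤ weightedEnergy (freqBox N) (fun k => freqNorm k ^ 2)
        (fieldCoeff (u (n + 1)) - fieldCoeff (u n)) := weightedEnergy_nonneg (fun _ => sq_nonneg _) _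
    gcongr
    linarith
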